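/- **Setting.** Let $\mathcal M$ be a finite-dimensional smooth Riemannian manifold with Riemannian distance $\mathrm{dist}$, and let $R:T\mathcal M\to\mathcal M$ be a retraction defined on the whole tangent bundle, i.e. a $C^\infty$ map with $R_x(0_x)=x$ and $\frac{d}{dt}R_x(t\eta)|_{t=0}=\eta$. Let $F=f+g$ with $f,g:\mathcal M\to\mathbb R$, $f$ differentiable and $g$ continuous. For $h:\mathcal M\to\mathbb R$ let $\partial h(x)=\partial(h\circ R_x)(0_x)$ be the Riemannian (Clarke) generalized subdifferential. **Algorithm (IRPG).** Given $x_0\in\mathcal M$, $\tilde L>0$ and $\varepsilon_k>0$, put $$\ell_{x_k}(\eta)=\langle \operatorname{grad} f(x_k),\eta\rangle+\tfrac{\tilde L}{2}\|\eta\|^2+g(R_{x_k}(\eta)),\qquad \eta\in T_{x_k}\mathcal M .$$ Choose $\hat\eta_k\in T_{x_k}\mathcal M$ and a stationary point $\eta^*_k$ of $\ell_{x_k}$ (that is, $0\in\partial\ell_{x_k}(\eta_k^*)$, Clarke subdifferential) such that $$\|\hat\eta_k-\eta_k^*\|\le\varepsilon_k^2,\qquad \ell_{x_k}(\hat\eta_k)\le\ell_{x_k}(0),$$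 and set $x_{k+1}=R_{x_k}(\hat\eta_k)$, for $k=0,1,2,\dots$ **Theorem.** Let $\{x_k\}$ be generated by this algorithm with $\sum_k\varepsilon_k<\infty$, and let $\mathcal S$ be the set of accumulation points of $\{x_k\}$. Suppose that: 1. $F$ is bounded from below and $\Omega_{x_0}=\{x: F(x)\le F(x_0)\}$ is compact. 2. $f$ is $L$-retraction-smooth with $L<\tilde L$ in a set $\mathcal N\subseteq\mathcal M$ that contains $\Omega_{x_0}$ and all the iterates $x_k$: $f(R_x(\eta))\le f(x)+\langle\operatorname{grad} f(x),\eta\rangle+\frac L2\|\eta\|^2$ whenever $x\in\mathcal N$, $\eta\in T_x\mathcal M$ and $R_x(\eta)\in\mathcal N$. 3. $\operatorname{grad} f$ is a locally Lipschitz vector field: for every compact $K\subseteq\mathcal M$ there are $r,L_v>0$ such that $\|P_\gamma^{0\leftarrow1}\operatorname{grad} f(y)-\operatorname{grad} f(x)\|\le L_v\,\mathrm{dist}(x,y)$ for all $x,y\in K$ and every geodesic $\gamma:[0,1]\to\mathcal M$ of length less than $r$ with $\gamma(0)=x$, $\gamma(1)=y$, where $P_\gamma^{0\leftarrow 1}$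 is parallel translation along $\gamma$. 4. $F$ is locally Lipschitz continuous with respect to $R$: for every compact $K\subseteq\mathcal M$ there is a constant $L_F$ with $|F(R_x(\xi))-F(R_x(\eta))|\le L_F\|\xi-\eta\|$ whenever $x\in K$, $\xi,\eta\in T_x\mathcal M$ and $R_x(\xi),R_x(\eta)\in K$. 5. $F$ has the Riemannian Kurdyka–Łojasiewicz property at every $x\in\mathcal S$: there are $\varepsilon\in(0,\infty]$, a neighborhood $U$ of $x$ and a continuous concave $\varsigma:[0,\varepsilon]\to[0,\infty)$ (on $[0,\infty)$ if $\varepsilon=\infty$) with $\varsigma(0)=0$, $\varsigma$ of class $C^1$ and $\varsigma'>0$ on $(0,\varepsilon)$, such that $\varsigma'(F(y)-F(x))\cdot\inf\{\|v\|_y: v\in\partial F(y)\}\ge1$ for every $y\in U$ with $F(x)<F(y)<F(x)+\varepsilon$. Then $$\sum_{k=0}^\infty \mathrm{dist}(x_k,x_{k+1})<\infty ,$$ and $\mathcal S$ consists of exactly one point. -/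

import Mathlib

open Bundle Set Filter Topology
open scoped Manifold ContDiff ENNReal NNReal

namespace IRPG

noncomputable section

/-! ### Clarke calculus on a Hilbert space -/

section Clarke

variable {V : Type*} [NormedAddCommGroup V] [InnerProductSpace ℝ V]

/-- Clarke generalized directional derivative
`h°(u; v) = limsup_{ξ → u, t ↓ 0} (h (ξ + t v) - h ξ) / t`, as an extended real. -/
def clarkeDirDeriv (h : V → ℝ) (u v : V) : EReal :=
  limsup (fun p : V × ℝ => (((h (p.1 + p.2 • v) - h p.1) / p.2 : ℝ) : EReal))
    (𝓝 u ×ˢ 𝓝[>] (0 : ℝ))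

/-- Clarke generalized subdifferential of `h` at `u`. -/
def clarkeSubdiff (h : V → ℝ) (u : V) : Set V :=
  {ξ | ∀ v : V, ((inner ℝ ξ v : ℝ) : EReal) ≤ clarkeDirDeriv h u v}

end Clarke

variable {E : Type*} [NormedAddCommGroup E] [NormedSpace ℝ E] [FiniteDimensional ℝ E]
  {M : Type*} [EMetricSpace M] [ChartedSpace E M] [IsManifold 𝓘(ℝ, E) ∞ M]
  [RiemannianBundle (fun x : M => TangentSpace 𝓘(ℝ, E) x)]

/-! ### Retractions -/

variable (E M) in
/-- A retraction, defined on the whole tangent bundle: a smooth map `R : TM → M` with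
`R 0ₓ = x` and `d/dt R (t η)|_{t = 0} = η`. -/
structure Retraction where
  toFun : ∀ x : M, TangentSpace 𝓘(ℝ, E) x → M
  smooth : ContMDiff 𝓘(ℝ, E).tangent 𝓘(ℝ, E) ∞
    (fun p : TangentBundle 𝓘(ℝ, E) M => toFun p.1 p.2)
  map_zero : ∀ x : M, toFun x 0 = x
  deriv_zero : ∀ (x : M) (η : TangentSpace 𝓘(ℝ, E) x),
    (mfderiv 𝓘(ℝ, ℝ) 𝓘(ℝ, E) (fun t : ℝ => toFun x (t • η)) 0 (1 : ℝ) : E) = (η : E)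

instance : CoeFun (Retraction E M) (fun _ => ∀ x : M, TangentSpace 𝓘(ℝ, E) x → M) :=
  ⟨Retraction.toFun⟩

/-! ### Gradient, subdifferential -/

/-- Riemannian gradient: the Riesz representative of the differential. -/
def grad (h : M → ℝ) (x : M) : TangentSpace 𝓘(ℝ, E) x :=
  haveI : FiniteDimensional ℝ (TangentSpace 𝓘(ℝ, E) x) :=
    inferInstanceAs (FiniteDimensional ℝ E)
  haveI : CompleteSpace (TangentSpace 𝓘(ℝ, E) x) := FiniteDimensional.complete ℝ _
  (InnerProductSpace.toDual ℝ (TangentSpace 𝓘(ℝ, E) x)).symm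
    (mvfderiv 𝓘(ℝ, E) h x)

lemma inner_grad (h : M → ℝ) (x : M) (v : TangentSpace 𝓘(ℝ, E) x) :
    inner ℝ (grad h x) v = mvfderiv 𝓘(ℝ, E) h x v := by
  have : FiniteDimensional ℝ (TangentSpace 𝓘(ℝ, E) x) :=
    inferInstanceAs (FiniteDimensional ℝ E)
  have : CompleteSpace (TangentSpace 𝓘(ℝ, E) x) := FiniteDimensional.complete ℝ _
  exact InnerProductSpace.toDual_symm_apply

/-- Riemannian generalized subdifferential `∂h(x) = ∂(h ∘ Rₓ)(0ₓ)`. -/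
def subdiff (R : Retraction E M) (h : M → ℝ) (x : M) : Set (TangentSpace 𝓘(ℝ, E) x) :=
  clarkeSubdiff (fun η : TangentSpace 𝓘(ℝ, E) x => h (R x η)) 0

/-- `dist (0, ∂h(x)) = inf {‖v‖ : v ∈ ∂h(x)}` (equal to `∞` if `∂h(x)` is empty). -/
def distZeroSubdiff (R : Retraction E M) (h : M → ℝ) (x : M) : ℝ≥0∞ :=
  ⨅ v ∈ subdiff R h x, ‖v‖ₑ

/-! ### Geodesics and parallel transport -/

/-- Coordinates of a tangent vector at `y` in the chart around `p`. -/
def chartVec (p y : M) (v : TangentSpace 𝓘(ℝ, E) y) : E :=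
  mvfderiv 𝓘(ℝ, E) (extChartAt 𝓘(ℝ, E) p) y v

/-- The metric tensor in the chart around `p`, at the coordinate point `z`. -/
def chartMetric (p : M) (z u w : E) : ℝ :=
  let D := mfderiv 𝓘(ℝ, E) 𝓘(ℝ, E) (extChartAt 𝓘(ℝ, E) p).symm z
  inner ℝ (D u : TangentSpace 𝓘(ℝ, E) ((extChartAt 𝓘(ℝ, E) p).symm z)) (D w)

/-- Christoffel symbols of the first kind of the Levi-Civita connection in the chart around `p`:
`½ (∂ₐ G(b, w) + ∂_b G(a, w) - ∂_w G(a, b))`, the value of `G(Γ(a, b), w)`. -/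
def christoffel (p : M) (z a b w : E) : ℝ :=
  (fderiv ℝ (fun z' => chartMetric p z' b w) z a
    + fderiv ℝ (fun z' => chartMetric p z' a w) z b
    - fderiv ℝ (fun z' => chartMetric p z' a b) z w) / 2

/-- Velocity of a curve parametrized by `[0, 1]`. -/
def velocity (γ : ℝ → M) (t : ℝ) : TangentSpace 𝓘(ℝ, E) (γ t) :=
  mfderivWithin 𝓘(ℝ, ℝ) 𝓘(ℝ, E) γ (Icc 0 1) t (1 : ℝ)

/-- `W` is parallel along `γ : [0, 1] → M` for the Levi-Civita connection: at every time, in local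
coordinates, `v' + Γ(c', v) = 0`, where `c` and `v` are the coordinate expressions of `γ` and `W`;
the equation is paired with an arbitrary vector `w` in the metric. The equation is invariant under
change of coordinates, so that it does not matter which chart is used at a given time. -/
def IsParallel (γ : ℝ → M) (W : ∀ t, TangentSpace 𝓘(ℝ, E) (γ t)) : Prop :=
  ∀ t ∈ Icc (0 : ℝ) 1, ∃ p : M, γ t ∈ (chartAt E p).source ∧ ∃ v' : E,
    HasDerivWithinAt (fun s => chartVec p (γ s) (W s)) v' (Icc 0 1) t ∧
    ∀ w : E, chartMetric p (extChartAt 𝓘(ℝ, E) p (γ t)) v' w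
      + christoffel p (extChartAt 𝓘(ℝ, E) p (γ t))
          (chartVec p (γ t) (velocity γ t)) (chartVec p (γ t) (W t)) w = 0

variable (E) in
/-- `γ : [0, 1] → M` is a geodesic: its velocity is parallel along it. -/
def IsGeodesic (γ : ℝ → M) : Prop :=
  ContMDiffOn 𝓘(ℝ, ℝ) 𝓘(ℝ, E) 1 γ (Icc 0 1) ∧ IsParallel γ (velocity (E := E) γ)

/-- A vector field `ξ` is locally Lipschitz continuous: on every compact set `K`, there is a
constant `L` with `‖P_γ^{0 ← 1} ξ_y - ξ_x‖ ≤ L dist(x, y)` for all `x, y ∈ K` close to each other,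
`γ` being the short geodesic from `x` to `y`. The vector `P_γ^{0 ← 1} ξ_y` is `W 0`, where `W` is
the parallel field along `γ` with `W 1 = ξ_y`. The length of `γ` is `‖γ'(0)‖`, and below the
injectivity radius of `K` the geodesics of length `< r` that start in `K` are the minimizing
geodesics to the points at distance `< r`. -/
def IsLocallyLipschitzField (ξ : ∀ x : M, TangentSpace 𝓘(ℝ, E) x) : Prop :=
  ∀ K : Set M, IsCompact K → ∃ r : ℝ, 0 < r ∧ ∃ L : ℝ≥0,
    ∀ γ : ℝ → M, IsGeodesic E γ → γ 0 ∈ K → γ 1 ∈ K → ‖velocity (E := E) γ 0‖ < r →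
      ∀ W : ∀ t, TangentSpace 𝓘(ℝ, E) (γ t), IsParallel γ W → W 1 = ξ (γ 1) →
        ‖W 0 - ξ (γ 0)‖ₑ ≤ L * edist (γ 0) (γ 1)

/-! ### Assumptions on the objective -/

variable (E) in
/-- `h` is differentiable and its Riemannian gradient is a locally Lipschitz vector field. -/
def IsLocallyLipschitzDifferentiable (h : M → ℝ) : Prop :=
  MDifferentiable 𝓘(ℝ, E) 𝓘(ℝ, ℝ) h ∧ IsLocallyLipschitzField (grad (E := E) h)

/-- `h` is locally Lipschitz continuous with respect to the retraction `R`. -/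
def IsLocallyLipschitzWrt (R : Retraction E M) (h : M → ℝ) : Prop :=
  ∀ K : Set M, IsCompact K → ∃ L : ℝ, ∀ x ∈ K, ∀ ξ η : TangentSpace 𝓘(ℝ, E) x,
    R x ξ ∈ K → R x η ∈ K → |h (R x ξ) - h (R x η)| ≤ L * ‖ξ - η‖

/-- `h` is `L`-retraction-smooth with respect to `R` in `N`. -/
def IsRetractionSmooth (R : Retraction E M) (h : M → ℝ) (L : ℝ) (N : Set M) : Prop :=
  ∀ x ∈ N, ∀ S : Set (TangentSpace 𝓘(ℝ, E) x), R x '' S ⊆ N → ∀ η ∈ S,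
    h (R x η) ≤ h x + inner ℝ (grad h x) η + L / 2 * ‖η‖ ^ 2

/-- Riemannian Kurdyka–Łojasiewicz property of `h` at `x`, with `ε ∈ (0, ∞]` and desingularising
function `ς` on `[0, ε]` (on `[0, ∞)` if `ε = ∞`). -/
def HasKLAt (R : Retraction E M) (h : M → ℝ) (x : M) : Prop :=
  ∃ ε : EReal, 0 < ε ∧ ∃ U ∈ 𝓝 x, ∃ ς : ℝ → ℝ,
    ContinuousOn ς {t : ℝ | 0 ≤ t ∧ (t : EReal) ≤ ε} ∧
    ConcaveOn ℝ {t : ℝ | 0 ≤ t ∧ (t : EReal) ≤ ε} ς ∧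
    (∀ t : ℝ, 0 ≤ t → (t : EReal) ≤ ε → 0 ≤ ς t) ∧
    ς 0 = 0 ∧
    ContDiffOn ℝ 1 ς {t : ℝ | 0 < t ∧ (t : EReal) < ε} ∧
    (∀ t : ℝ, 0 < t → (t : EReal) < ε → 0 < deriv ς t) ∧
    ∀ y ∈ U, h x < h y → ((h y - h x : ℝ) : EReal) < ε →
      1 ≤ ENNReal.ofReal (deriv ς (h y - h x)) * distZeroSubdiff R h y

/-! ### The algorithm -/

/-- The objective `ℓₓ(η) = ⟨grad f(x), η⟩ + (Lt / 2) ‖η‖² + g (Rₓ η)` of the proximal mapping. -/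
def proxObj (R : Retraction E M) (f g : M → ℝ) (Lt : ℝ) (x : M)
    (η : TangentSpace 𝓘(ℝ, E) x) : ℝ :=
  inner ℝ (grad f x) η + Lt / 2 * ‖η‖ ^ 2 + g (R x η)

/-- `x` is a sequence generated by the inexact Riemannian proximal gradient method with accuracy
function `q`; `ηs k` is a stationary point of the `k`-th proximal mapping and `ηh k` its computed
approximation. -/
structure IsIRPG (R : Retraction E M) (f g : M → ℝ) (Lt : ℝ) (q : ℝ → ℝ → ℝ) (ε : ℕ → ℝ)
    (x : ℕ → M) (ηh ηs : ∀ k, TangentSpace 𝓘(ℝ, E) (x k)) : Prop where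
  eps_pos : ∀ k, 0 < ε k
  stationary : ∀ k, 0 ∈ clarkeSubdiff (proxObj R f g Lt (x k)) (ηs k)
  accuracy : ∀ k, ‖ηh k - ηs k‖ ≤ q (ε k) ‖ηh k‖
  decrease : ∀ k, proxObj R f g Lt (x k) (ηh k) ≤ proxObj R f g Lt (x k) 0
  step : ∀ k, x (k + 1) = R (x k) (ηh k)

end

end IRPG

/-!
Sufficient decrease bounds `β ‖η̂ₖ‖²` by `F (xₖ) - F (xₖ₊₁)`, so the steps tend to `0`, and with
them the distance between `η̂ₖ` and the stationary point `ηₖ*`.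

Near a point `p`, the map `R_y⁻¹ ∘ R_x` between the tangent spaces at `x` and at `y = R_x ηₖ*` is
close to the identity in coordinates. By the one-sided chain rule for Clarke derivatives, which
needs no regularity of `g`, it turns the stationarity of `ηₖ*` into a subgradient of `F` at `y`.
The norm of this subgradient is `O(‖ηₖ*‖)` as `grad f` is Lipschitz in coordinates; the hypothesis
only speaks of parallel transport along geodesics, and is put to use by constructing the geodesic
between two nearby points (a two-point boundary value problem solved by contraction) and the
parallel field along it (a linear equation).

With the Kurdyka–Łojasiewicz inequality at `p` and the concavity of the desingularizing function
`ς`, this gives `β ‖η̂ₖ₊₁‖² ≤ C εₖ² + C ‖ηₖ*‖ (ς (aₖ₊₁) - ς (aₖ₊₂))`, `aₖ = F (xₖ) - F p`, for the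
steps starting near a cluster point `p`. By compactness, one such bound with a summable sequence in
place of the last factor holds for all late steps, and by the inequality of arithmetic and geometric
means the `‖η̂ₖ‖` are summable.
-/

namespace IRPG

/-! ### Clarke derivatives, recursive inequalities, concave functions -/

section Clarke

lemma eventually_snd_pos {X : Type*} (l : Filter X) :
    ∀ᶠ p : X × ℝ in l ×ˢ 𝓝[>] (0 : ℝ), 0 < p.2 :=
  tendsto_snd.eventually self_mem_nhdsWithin

section Quotients

variable {V W : Type*} [NormedAddCommGroup V] [NormedSpace ℝ V]
  [NormedAddCommGroup W] [NormedSpace ℝ W]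

lemma tendsto_fst_add_snd_smul (u v : V) :
    Tendsto (fun p : V × ℝ => p.1 + p.2 • v) (𝓝 u ×ˢ 𝓝[>] (0 : ℝ)) (𝓝 u) := by
  have hsnd : Tendsto Prod.snd (𝓝 u ×ˢ 𝓝[>] (0 : ℝ)) (𝓝 0) :=
    tendsto_snd.mono_right nhdsWithin_le_nhds
  simpa using tendsto_fst.add (hsnd.smul_const v)

lemma tendsto_inv_smul_sub_of_hasStrictFDerivAt {ψ : V → W} {A : V →L[ℝ] W} {u : V}
    (hψ : HasStrictFDerivAt ψ A u) (v : V) :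
    Tendsto (fun p : V × ℝ => p.2⁻¹ • (ψ (p.1 + p.2 • v) - ψ p.1)) (𝓝 u ×ˢ 𝓝[>] (0 : ℝ))
      (𝓝 (A v)) := by
  have hlim : Tendsto (fun p : V × ℝ => (p.1 + p.2 • v, p.1)) (𝓝 u ×ˢ 𝓝[>] (0 : ℝ)) (𝓝 (u, u)) :=
    (tendsto_fst_add_snd_smul u v).prodMk_nhds tendsto_fst
  have hO : (fun p : V × ℝ => p.1 + p.2 • v - p.1) =O[𝓝 u ×ˢ 𝓝[>] (0 : ℝ)] Prod.snd :=
    .of_bound ‖v‖ (.of_forall fun p => by simp [norm_smul, mul_comm])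
  have h0 := ((hψ.isLittleO.comp_tendsto hlim).trans_isBigO hO).tendsto_inv_smul_nhds_zero
  refine (zero_add (A v) ▸ h0.add_const (A v)).congr' ?_
  filter_upwards [eventually_snd_pos (𝓝 u)] with p hp
  simp [smul_sub, smul_smul, hp.ne']

lemma tendsto_div_comp_sub {h : W → ℝ} {ψ : V → W} {A : V →L[ℝ] W} {u : V}
    (hψ : HasStrictFDerivAt ψ A u) {K : ℝ≥0} {U : Set W} (hU : U ∈ 𝓝 (ψ u))
    (hh : LipschitzOnWith K h U) (v : V) :
    Tendsto (fun p : V × ℝ => (h (ψ (p.1 + p.2 • v)) - h (ψ p.1 + p.2 • A v)) / p.2)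
      (𝓝 u ×ˢ 𝓝[>] (0 : ℝ)) (𝓝 0) := by
  have hψu : Tendsto ψ (𝓝 u) (𝓝 (ψ u)) := hψ.continuousAt
  have hlin : Tendsto (fun p : V × ℝ => ψ p.1 + p.2 • A v) (𝓝 u ×ˢ 𝓝[>] (0 : ℝ)) (𝓝 (ψ u)) :=
    (tendsto_fst_add_snd_smul (ψ u) (A v)).comp ((hψu.comp tendsto_fst).prodMk tendsto_snd)
  have herr := (tendsto_inv_smul_sub_of_hasStrictFDerivAt hψ v).sub_const (A v)
  rw [sub_self] at herr
  refine squeeze_zero_norm' ?_ (by simpa using herr.norm.const_mul (K : ℝ))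
  filter_upwards [(hψu.comp (tendsto_fst_add_snd_smul u v)).eventually hU, hlin.eventually hU,
    eventually_snd_pos (𝓝 u)] with p hp hp' ht
  rw [norm_div, Real.norm_of_nonneg ht.le, div_le_iff₀ ht, mul_assoc]
  refine (hh.norm_sub_le hp hp').trans_eq ?_
  rw [← Real.norm_of_nonneg ht.le, mul_comm ‖_‖ ‖p.2‖, ← norm_smul, Real.norm_of_nonneg ht.le,
    smul_sub, smul_inv_smul₀ ht.ne', sub_sub, Function.comp_apply]

end Quotients

variable {V W : Type*} [NormedAddCommGroup V] [InnerProductSpace ℝ V]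
  [NormedAddCommGroup W] [InnerProductSpace ℝ W]

lemma clarkeDirDeriv_congr {h₁ h₂ : V → ℝ} {u : V} (h : h₁ =ᶠ[𝓝 u] h₂) (v : V) :
    clarkeDirDeriv h₁ u v = clarkeDirDeriv h₂ u v := by
  refine limsup_congr ?_
  filter_upwards [tendsto_fst.eventually h, (tendsto_fst_add_snd_smul u v).eventually h]
    with p hp hp'
  rw [hp, hp']

lemma clarkeDirDeriv_comp_add_le {h : W → ℝ} {ψ : V → W} {s : V → ℝ} {A : V →L[ℝ] W}
    {S : V →L[ℝ] ℝ} {u : V} (hψ : HasStrictFDerivAt ψ A u) (hs : HasStrictFDerivAt s S u)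
    {K : ℝ≥0} {U : Set W} (hU : U ∈ 𝓝 (ψ u)) (hh : LipschitzOnWith K h U) (v : V) :
    clarkeDirDeriv (fun ξ => h (ψ ξ) + s ξ) u v ≤
      clarkeDirDeriv h (ψ u) (A v) + ((S v : ℝ) : EReal) := by
  have hrest := (tendsto_div_comp_sub hψ hU hh v).add
    (tendsto_inv_smul_sub_of_hasStrictFDerivAt hs v)
  rw [zero_add] at hrest
  have hlim := ((continuous_coe_real_ereal.tendsto (S v)).comp hrest).limsup_eq
  have hmap : Tendsto (fun p : V × ℝ => (ψ p.1, p.2)) (𝓝 u ×ˢ 𝓝[>] (0 : ℝ))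
      (𝓝 (ψ u) ×ˢ 𝓝[>] (0 : ℝ)) :=
    (hψ.continuousAt.tendsto.comp tendsto_fst).prodMk tendsto_snd
  have hmain : limsup (fun p : V × ℝ =>
      (((h (ψ p.1 + p.2 • A v) - h (ψ p.1)) / p.2 : ℝ) : EReal)) (𝓝 u ×ˢ 𝓝[>] (0 : ℝ)) ≤
      clarkeDirDeriv h (ψ u) (A v) :=
    limsSup_le_limsSup_of_le (map_map.symm.trans_le (map_mono hmap))
  rw [← hlim]
  refine le_trans ?_ ((EReal.limsup_add_le (.inr (hlim ▸ EReal.coe_ne_top _))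
    (.inr (hlim ▸ EReal.coe_ne_bot _))).trans (add_le_add_left hmain _))
  refine (limsup_congr (.of_forall fun p => ?_)).le
  simp only [Pi.add_apply, Function.comp_apply, ← EReal.coe_add, smul_eq_mul]
  congr 1
  ring

end Clarke

section Sequences

lemma summable_of_succ_le_half_add {n e : ℕ → ℝ} (hn : ∀ k, 0 ≤ n k) (he0 : ∀ k, 0 ≤ e k)
    (he : Summable e) (h : ∀ k, n (k + 1) ≤ n k / 2 + e k) : Summable n := by
  refine summable_of_sum_range_le (c := 2 * (n 0 + ∑' k, e k)) hn fun m => ?_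
  have hsum : ∑ k ∈ Finset.range (m + 1), n k ≤
      n 0 + (∑ k ∈ Finset.range m, n k) / 2 + ∑ k ∈ Finset.range m, e k := by
    rw [Finset.sum_range_succ', Finset.sum_div, add_assoc, ← Finset.sum_add_distrib, add_comm]
    gcongr with k
    exact h k
  have herr := he.sum_le_tsum (Finset.range m) (fun k _ => he0 k)
  have hmono : ∑ k ∈ Finset.range m, n k ≤ ∑ k ∈ Finset.range (m + 1), n k :=
    Finset.sum_le_sum_of_subset_of_nonneg (by simp) (fun k _ _ => hn k)
  linarith

lemma summable_sq_of_summable {e : ℕ → ℝ} (he0 : ∀ k, 0 ≤ e k) (he : Summable e) :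
    Summable fun k => e k ^ 2 := by
  have hle : ∀ᶠ k in atTop, e k ≤ 1 := he.tendsto_atTop_zero.eventually_le_const zero_lt_one
  refine .of_norm_bounded_eventually_nat he (hle.mono fun k hk => ?_)
  rw [Real.norm_of_nonneg (sq_nonneg _)]
  exact pow_le_of_le_one (he0 k) hk two_ne_zero

lemma le_half_add_of_sq_le {x m p e q : ℝ} (hm : 0 ≤ m) (hp : 0 ≤ p) (he : 0 ≤ e) (hq : 0 ≤ q)
    (h : x ^ 2 ≤ p * e ^ 2 + m * q) : x ≤ m / 2 + (p + 1) * e + q := by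
  refine le_of_sq_le_sq (h.trans ?_) (by positivity)
  have hrest : 0 ≤ m ^ 2 / 4 + q ^ 2 + (m + 2 * q) * (p + 1) * e + (p ^ 2 + p + 1) * e ^ 2 := by
    positivity
  linear_combination hrest

lemma summable_of_sq_succ_le {n m e D : ℕ → ℝ} {p : ℝ} (hp : 0 ≤ p) (hn : ∀ k, 0 ≤ n k)
    (hm : ∀ k, 0 ≤ m k) (he0 : ∀ k, 0 ≤ e k) (hD0 : ∀ k, 0 ≤ D k) (he : Summable e)
    (hD : Summable D) (hmn : ∀ k, m k ≤ n k + e k ^ 2)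
    (h : ∀ k, n (k + 1) ^ 2 ≤ p * e k ^ 2 + m k * D k) : Summable n := by
  have herr : Summable fun k => e k ^ 2 / 2 + (p + 1) * e k + D k :=
    (((summable_sq_of_summable he0 he).div_const 2).add (he.mul_left _)).add hD
  refine summable_of_succ_le_half_add hn (fun k => ?_) herr fun k => ?_
  · have := he0 k
    have := hD0 k
    positivity
  · linarith [le_half_add_of_sq_le (hm k) hp (he0 k) (hD0 k) (h k), hmn k]

lemma summable_sub_succ_of_antitone {s : ℕ → ℝ} {b : ℝ} (hs : Antitone s) (hb : ∀ k, b ≤ s k) :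
    Summable fun k => s k - s (k + 1) := by
  refine summable_of_sum_range_le (c := s 0 - b) (fun k => sub_nonneg.2 (hs k.le_succ)) fun n => ?_
  rw [Finset.sum_range_sub']
  linarith [hb n]

end Sequences

section Concave

variable {s : Set ℝ} {ς : ℝ → ℝ} {a t b : ℝ}

lemma deriv_mul_le_sub_of_concaveOn (hς : ConcaveOn ℝ s ς) (ha : a ∈ s) (hb : b ∈ s) (hat : a < t)
    (htb : t ≤ b) (hd : DifferentiableAt ℝ ς b) : deriv ς b * (t - a) ≤ ς t - ς a := by
  have ht : t ∈ s := hς.1.ordConnected.out ha hb ⟨hat.le, htb⟩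
  have hslope : deriv ς b ≤ slope ς a t :=
    (hς.deriv_le_slope ha hb (hat.trans_le htb) hd).trans
      (hς.slope_anti ha ⟨ht, hat.ne'⟩ ⟨hb, (hat.trans_le htb).ne'⟩ htb)
  rwa [slope_def_field, le_div_iff₀ (sub_pos.2 hat)] at hslope

lemma le_of_concaveOn_of_deriv_pos (hς : ConcaveOn ℝ s ς) (ha : a ∈ s) (hb : b ∈ s) (hat : a ≤ t)
    (htb : t ≤ b) (hd : t < b → 0 < deriv ς b) : ς t ≤ ς b := by
  rcases htb.eq_or_lt with rfl | htb
  · rfl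
  have ht : t ∈ s := hς.1.ordConnected.out ha hb ⟨hat, htb.le⟩
  have hpos := mul_pos (hd htb) (sub_pos.2 htb)
  linarith [deriv_mul_le_sub_of_concaveOn hς ht hb htb le_rfl
    (differentiableAt_of_deriv_ne_zero (hd htb).ne')]

lemma sub_le_add_mul_sub_of_concaveOn {a' X m : ℝ} (hς : ConcaveOn ℝ s ς) (ha' : a' ∈ s)
    (ha : a ∈ s) (hb : a' < b → b ∈ s) (haa : a' ≤ a) (hX : |b - a| ≤ X) (hm : 0 ≤ m)
    (hd : a' < a → 0 < deriv ς a) (hKL : a' < b → 1 ≤ deriv ς b * m) :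
    a - a' ≤ X + m * (ς a - ς a') := by
  obtain ⟨hX₁, hX₂⟩ := abs_le.1 hX
  have hmono : 0 ≤ m * (ς a - ς a') :=
    mul_nonneg hm (sub_nonneg.2 (le_of_concaveOn_of_deriv_pos hς ha' ha le_rfl haa hd))
  rcases le_or_gt b a' with hba | hba
  · linarith
  rcases haa.eq_or_lt with rfl | haa
  · linarith
  have hmin : a' < min a b := lt_min haa hba
  have hdiff : DifferentiableAt ℝ ς b := differentiableAt_of_deriv_ne_zero fun h0 => by
    linarith [hKL hba, h0 ▸ zero_mul m]
  have hslope := deriv_mul_le_sub_of_concaveOn hς ha' (hb hba) hmin (min_le_right a b) hdiff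
  have hle : ς (min a b) ≤ ς a :=
    le_of_concaveOn_of_deriv_pos hς ha' ha hmin.le (min_le_left a b) fun _ => hd haa
  have hKL' : min a b - a' ≤ m * (ς a - ς a') :=
    calc min a b - a' ≤ deriv ς b * m * (min a b - a') :=
          le_mul_of_one_le_left (sub_pos.2 hmin).le (hKL hba)
      _ = m * (deriv ς b * (min a b - a')) := by ring
      _ ≤ m * (ς a - ς a') := mul_le_mul_of_nonneg_left (hslope.trans (by linarith)) hm
  have hmin' : a - X ≤ min a b := le_min (by linarith) (by linarith)
  linarith

end Concave

/-! ### Two-point boundary value problems and linear equations -/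

section TwoPointProblem

variable {E : Type*} [NormedAddCommGroup E]

lemma continuous_iccExtend (u : C(unitInterval, E)) : Continuous (IccExtend zero_le_one u) :=
  u.continuous.Icc_extend'

lemma norm_iccExtend_le (u : C(unitInterval, E)) (s : ℝ) : ‖IccExtend zero_le_one u s‖ ≤ ‖u‖ :=
  u.norm_coe_le_norm _

lemma norm_iccExtend_sub_le (u u' : C(unitInterval, E)) (s : ℝ) :
    ‖IccExtend zero_le_one u s - IccExtend zero_le_one u' s‖ ≤ dist u u' := by
  rw [← dist_eq_norm]
  exact ContinuousMap.dist_apply_le_dist _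

lemma norm_le_div_four_of_lipschitzOnWith {N : E × E → E} (hN₀ : ∀ z, N (z, 0) = 0)
    {ρ : ℝ} (hN : LipschitzOnWith (1 / 4) N (univ ×ˢ Metric.closedBall 0 ρ)) {z w : E}
    (hw : ‖w‖ ≤ ρ) : ‖N (z, w)‖ ≤ ρ / 4 := by
  have hlip := hN.norm_sub_le (x := (z, w)) (y := (z, 0)) (by simpa using hw)
    (by simpa using (norm_nonneg w).trans hw)
  simp only [hN₀, sub_zero, Prod.mk_sub_mk, sub_self, Prod.norm_mk, norm_zero,
    max_eq_right (norm_nonneg w), NNReal.coe_div, NNReal.coe_one, NNReal.coe_ofNat] at hlip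
  linarith

variable [NormedSpace ℝ E]

lemma norm_integral_le_of_Icc {f : ℝ → E} {B a b : ℝ} (hB : 0 ≤ B) (ha : a ∈ Icc (0 : ℝ) 1)
    (hb : b ∈ Icc (0 : ℝ) 1) (hf : ∀ s ∈ Icc (0 : ℝ) 1, ‖f s‖ ≤ B) : ‖∫ s in a..b, f s‖ ≤ B := by
  have hint : ‖∫ s in a..b, f s‖ ≤ B * |b - a| :=
    intervalIntegral.norm_integral_le_of_norm_le_const fun s hs =>
      hf s (uIcc_subset_Icc ha hb (uIoc_subset_uIcc hs))
  exact hint.trans (mul_le_of_le_one_right hB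
    (abs_le.2 ⟨by linarith [ha.2, hb.1], by linarith [ha.1, hb.2]⟩))

/-- The primitive of `g` whose integral over `[0, 1]` vanishes. -/
noncomputable def zeroMeanPrimitive (g : ℝ → E) (t : ℝ) : E :=
  (∫ s in (0 : ℝ)..t, g s) - ∫ τ in (0 : ℝ)..1, ∫ s in (0 : ℝ)..τ, g s

section

variable {g g' : ℝ → E}

lemma continuous_primitive (hg : Continuous g) : Continuous fun t => ∫ s in (0 : ℝ)..t, g s :=
  intervalIntegral.continuous_primitive (fun _ _ => hg.intervalIntegrable _ _) 0

lemma continuous_zeroMeanPrimitive (hg : Continuous g) : Continuous (zeroMeanPrimitive g) :=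
  (continuous_primitive hg).sub continuous_const

lemma zeroMeanPrimitive_sub (hg : Continuous g) (hg' : Continuous g') (t : ℝ) :
    zeroMeanPrimitive g t - zeroMeanPrimitive g' t = zeroMeanPrimitive (fun s => g s - g' s) t := by
  have hsub : ∀ τ, ∫ s in (0 : ℝ)..τ, g s - g' s =
      (∫ s in (0 : ℝ)..τ, g s) - ∫ s in (0 : ℝ)..τ, g' s := fun τ =>
    intervalIntegral.integral_sub (hg.intervalIntegrable _ _) (hg'.intervalIntegrable _ _)
  simp only [zeroMeanPrimitive, hsub]
  rw [intervalIntegral.integral_sub ((continuous_primitive hg).intervalIntegrable _ _)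
    ((continuous_primitive hg').intervalIntegrable _ _), sub_sub_sub_comm]

lemma norm_zeroMeanPrimitive_le {B t : ℝ} (hg : ∀ s ∈ Icc (0 : ℝ) 1, ‖g s‖ ≤ B)
    (ht : t ∈ Icc (0 : ℝ) 1) : ‖zeroMeanPrimitive g t‖ ≤ 2 * B := by
  have hB : 0 ≤ B := (norm_nonneg _).trans (hg t ht)
  have h0 : (0 : ℝ) ∈ Icc (0 : ℝ) 1 := by simp
  have hprim : ∀ τ ∈ Icc (0 : ℝ) 1, ‖∫ s in (0 : ℝ)..τ, g s‖ ≤ B := fun τ hτ =>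
    norm_integral_le_of_Icc hB h0 hτ hg
  calc ‖zeroMeanPrimitive g t‖ ≤ B + B :=
        norm_sub_le_of_le (hprim t ht) (norm_integral_le_of_Icc hB h0 (by simp) hprim)
    _ = 2 * B := by ring

variable [CompleteSpace E]

lemma hasDerivAt_zeroMeanPrimitive (hg : Continuous g) (t : ℝ) :
    HasDerivAt (zeroMeanPrimitive g) (g t) t :=
  (hg.integral_hasStrictDerivAt 0 t).hasDerivAt.sub_const _

lemma integral_zeroMeanPrimitive (hg : Continuous g) :
    ∫ t in (0 : ℝ)..1, zeroMeanPrimitive g t = 0 := by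
  simp only [zeroMeanPrimitive]
  rw [intervalIntegral.integral_sub ((continuous_primitive hg).intervalIntegrable _ _)
    intervalIntegrable_const]
  simp

end

lemma exists_fixedPoint_of_lipschitzOnWith_half {X : Type*} [MetricSpace X] [CompleteSpace X]
    {s : Set X} (hs : IsClosed s) (hne : s.Nonempty) {T : X → X} (hT : MapsTo T s s)
    (hlip : LipschitzOnWith (1 / 2) T s) : ∃ x ∈ s, T x = x := by
  obtain ⟨x, hx⟩ := hne
  have hc : ContractingWith (1 / 2) (hT.restrict T s s) :=
    ⟨by norm_num, hlip.mapsToRestrict hT⟩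
  obtain ⟨y, hy, hfix, -⟩ := hc.exists_fixedPoint' hs.isComplete hT hx (edist_ne_top _ _)
  exact ⟨y, hy, hfix⟩

/-- The curve that starts at `z` with velocity `u`. -/
noncomputable def curveOfVelocity (z : E) (u : ℝ → E) (t : ℝ) : E :=
  z + ∫ s in (0 : ℝ)..t, u s

lemma continuous_curveOfVelocity (z : E) {u : ℝ → E} (hu : Continuous u) :
    Continuous (curveOfVelocity z u) :=
  continuous_const.add (continuous_primitive hu)

lemma norm_curveOfVelocity_sub_le (z : E) {u u' : ℝ → E} (hu : Continuous u) (hu' : Continuous u')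
    {B t : ℝ} (hB : 0 ≤ B) (huu : ∀ s, ‖u s - u' s‖ ≤ B) (ht : t ∈ Icc (0 : ℝ) 1) :
    ‖curveOfVelocity z u t - curveOfVelocity z u' t‖ ≤ B := by
  rw [curveOfVelocity, curveOfVelocity, add_sub_add_left_eq_sub, ← intervalIntegral.integral_sub
    (hu.intervalIntegrable _ _) (hu'.intervalIntegrable _ _)]
  exact norm_integral_le_of_Icc hB (by simp) ht fun s _ => huu s

section Contraction

variable {N : E × E → E}

lemma exists_velocity_of_lipschitzOnWith [CompleteSpace E] (hNc : Continuous N)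
    (hN₀ : ∀ z, N (z, 0) = 0) (z a : E)
    (hN : LipschitzOnWith (1 / 4) N (univ ×ˢ Metric.closedBall 0 (2 * ‖a‖))) :
    ∃ u : ℝ → E, Continuous u ∧ (∀ t, ‖u t‖ ≤ 2 * ‖a‖) ∧ ∀ t ∈ Icc (0 : ℝ) 1,
      u t = a + zeroMeanPrimitive (fun s => N (curveOfVelocity z u s, u s)) t := by
  let ext (u : C(unitInterval, E)) : ℝ → E := IccExtend zero_le_one u
  have hext : ∀ u, Continuous (ext u) := continuous_iccExtend
  let acc (u : C(unitInterval, E)) (s : ℝ) : E := N (curveOfVelocity z (ext u) s, ext u s)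
  have hacc : ∀ u, Continuous (acc u) := fun u =>
    hNc.comp ((continuous_curveOfVelocity z (hext u)).prodMk (hext u))
  let T (u : C(unitInterval, E)) : C(unitInterval, E) :=
    ⟨fun t => a + zeroMeanPrimitive (acc u) t,
      continuous_const.add ((continuous_zeroMeanPrimitive (hacc u)).comp continuous_subtype_val)⟩
  obtain ⟨u, hu, hfix⟩ : ∃ u ∈ Metric.closedBall (0 : C(unitInterval, E)) (2 * ‖a‖), T u = u := by
    refine exists_fixedPoint_of_lipschitzOnWith_half Metric.isClosed_closedBall ⟨0, by simp⟩
      (fun u hu => ?_) (.of_dist_le_mul fun u hu u' hu' => ?_)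
    · rw [mem_closedBall_zero_iff] at hu ⊢
      refine (ContinuousMap.norm_le _ (by positivity)).2 fun t => ?_
      have hbound : ∀ s ∈ Icc (0 : ℝ) 1, ‖acc u s‖ ≤ 2 * ‖a‖ / 4 := fun s _ =>
        norm_le_div_four_of_lipschitzOnWith hN₀ hN ((norm_iccExtend_le u s).trans hu)
      refine (norm_add_le_of_le le_rfl (norm_zeroMeanPrimitive_le hbound t.2)).trans_eq ?_
      ring
    · rw [mem_closedBall_zero_iff] at hu hu'
      refine (ContinuousMap.dist_le (by positivity)).2 fun t => ?_
      have hbound : ∀ s ∈ Icc (0 : ℝ) 1, ‖acc u s - acc u' s‖ ≤ dist u u' / 4 := fun s hs => by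
        refine (hN.norm_sub_le (by simpa using (norm_iccExtend_le u s).trans hu)
          (by simpa using (norm_iccExtend_le u' s).trans hu')).trans ?_
        rw [Prod.mk_sub_mk, Prod.norm_mk, NNReal.coe_div, NNReal.coe_one, NNReal.coe_ofNat,
          one_div, div_eq_inv_mul]
        gcongr
        exact max_le (norm_curveOfVelocity_sub_le z (hext u) (hext u') dist_nonneg
          (norm_iccExtend_sub_le u u') hs) (norm_iccExtend_sub_le u u' s)
      simp only [T, ContinuousMap.coe_mk, dist_add_left]
      rw [dist_eq_norm, zeroMeanPrimitive_sub (hacc u) (hacc u')]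
      refine (norm_zeroMeanPrimitive_le hbound t.2).trans_eq ?_
      push_cast
      ring
  refine ⟨ext u, hext u, fun t => (norm_iccExtend_le u t).trans (mem_closedBall_zero_iff.1 hu),
    fun t ht => ?_⟩
  calc ext u t = u ⟨t, ht⟩ := IccExtend_of_mem _ _ ht
    _ = T u ⟨t, ht⟩ := by rw [hfix]

/-- Two-point boundary value problem `c'' = N (c, c')`, `c 0 = z₁`, `c 1 = z₂`. -/
lemma exists_twoPoint_solution [CompleteSpace E] (hNc : Continuous N)
    (hN₀ : ∀ z, N (z, 0) = 0) {z₁ z₂ : E}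
    (hN : LipschitzOnWith (1 / 4) N (univ ×ˢ Metric.closedBall 0 (2 * ‖z₂ - z₁‖))) :
    ∃ c u : ℝ → E, c 0 = z₁ ∧ c 1 = z₂ ∧ Continuous u ∧ (∀ t, HasDerivAt c (u t) t) ∧
      (∀ t, ‖u t‖ ≤ 2 * ‖z₂ - z₁‖) ∧
      ∀ t ∈ Icc (0 : ℝ) 1, HasDerivWithinAt u (N (c t, u t)) (Icc 0 1) t := by
  obtain ⟨u, hu, hbound, hfix⟩ := exists_velocity_of_lipschitzOnWith hNc hN₀ z₁ (z₂ - z₁) hN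
  have hacc : Continuous fun s => N (curveOfVelocity z₁ u s, u s) :=
    hNc.comp ((continuous_curveOfVelocity z₁ hu).prodMk hu)
  refine ⟨curveOfVelocity z₁ u, u, by simp [curveOfVelocity], ?_, hu,
    fun t => (hu.integral_hasStrictDerivAt 0 t).hasDerivAt.const_add z₁, hbound, fun t ht => ?_⟩
  · have hint : ∫ s in (0 : ℝ)..1, u s = z₂ - z₁ := by
      rw [intervalIntegral.integral_congr fun s hs => hfix s (by simpa using hs),
        intervalIntegral.integral_add intervalIntegrable_const
          ((continuous_zeroMeanPrimitive hacc).intervalIntegrable _ _),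
        integral_zeroMeanPrimitive hacc]
      simp
    rw [curveOfVelocity, hint, add_sub_cancel]
  · exact ((hasDerivAt_zeroMeanPrimitive hacc t).const_add _).hasDerivWithinAt.congr hfix
      (hfix t ht)

end Contraction

set_option synthInstance.maxHeartbeats 200000 in
-- The search for the norm on `E →L[ℝ] E →L[ℝ] E` exceeds the default limit.
lemma lipschitzOnWith_quadratic {Γ : E → E →L[ℝ] E →L[ℝ] E} {K C : ℝ≥0}
    (hK : LipschitzWith K Γ) (hC : ∀ z, ‖Γ z‖ ≤ C) {ρ : ℝ≥0} (hρ : 16 * (K + C) * ρ + ρ ≤ 2) :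
    LipschitzOnWith (1 / 4) (fun p : E × E => -(Γ p.1 p.2 p.2))
      (univ ×ˢ Metric.closedBall 0 ρ) := by
  refine .of_dist_le_mul fun ⟨z, w⟩ hw ⟨z', w'⟩ hw' => ?_
  replace hw : ‖w‖ ≤ ρ := by simpa using hw
  replace hw' : ‖w'‖ ≤ ρ := by simpa using hw'
  set d := dist (z, w) (z', w')
  have hz : ‖z - z'‖ ≤ d := by rw [← dist_eq_norm]; exact le_max_left _ _
  have hww : ‖w - w'‖ ≤ d := by rw [← dist_eq_norm]; exact le_max_right _ _
  have hΓ : ‖Γ z - Γ z'‖ ≤ K * d := (hK.norm_sub_le z z').trans (by gcongr)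
  have hsplit : Γ z w w - Γ z' w' w' =
      (Γ z - Γ z') w w + Γ z' (w - w') w + Γ z' w' (w - w') := by
    simp only [map_sub, sub_apply]
    abel
  have hρ' : 16 * (K + C) * (ρ : ℝ) + ρ ≤ 2 := by exact_mod_cast hρ
  have hKρ : 0 ≤ (K : ℝ) * ρ := by positivity
  have hCρ : 0 ≤ (C : ℝ) * ρ := by positivity
  rw [dist_eq_norm, neg_sub_neg, norm_sub_rev, hsplit]
  calc ‖(Γ z - Γ z') w w + Γ z' (w - w') w + Γ z' w' (w - w')‖
      ≤ K * d * ρ * ρ + C * d * ρ + C * ρ * d :=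
        norm_add₃_le.trans (add_le_add_three
          ((ContinuousLinearMap.le_opNorm₂ _ _ _).trans (by gcongr))
          ((ContinuousLinearMap.le_opNorm₂ _ _ _).trans (by gcongr; exact hC z'))
          ((ContinuousLinearMap.le_opNorm₂ _ _ _).trans (by gcongr; exact hC z')))
    _ = (K * ρ * ρ + 2 * (C * ρ)) * d := by ring
    _ ≤ 1 / 4 * d := by
        refine mul_le_mul_of_nonneg_right ?_ dist_nonneg
        nlinarith [hρ', hKρ, hCρ, ρ.2]

end TwoPointProblem

section LinearEquation

variable {E : Type*} [NormedAddCommGroup E] [NormedSpace ℝ E] {A : ℝ → E →L[ℝ] E} {θ : ℝ≥0}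

lemma norm_sub_le_of_linear_equation (hθ : ∀ t ∈ Icc (0 : ℝ) 1, ‖A t‖ ≤ θ) (hθ₂ : θ ≤ 1 / 2)
    {v : ℝ → E} (hv : ∀ t ∈ Icc (0 : ℝ) 1, HasDerivWithinAt v (-(A t (v t))) (Icc 0 1) t)
    {t : ℝ} (ht : t ∈ Icc (0 : ℝ) 1) : ‖v t - v 1‖ ≤ 2 * θ * ‖v 1‖ := by
  have hcont : ContinuousOn v (Icc 0 1) := fun s hs => (hv s hs).continuousWithinAt
  obtain ⟨m, hm, hmax⟩ := isCompact_Icc.exists_isMaxOn ⟨1, by simp⟩ hcont.norm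
  have hsub : ∀ s ∈ Icc (0 : ℝ) 1, ‖v s - v 1‖ ≤ θ * ‖v m‖ := fun s hs => by
    have hmvt := (convex_Icc (0 : ℝ) 1).norm_image_sub_le_of_norm_hasDerivWithin_le
      (C := θ * ‖v m‖) hv (fun r hr => by
        rw [norm_neg]
        exact (A r).le_of_opNorm_le_of_le (hθ r hr) (hmax hr)) (show (1 : ℝ) ∈ Icc 0 1 by simp) hs
    refine hmvt.trans (mul_le_of_le_one_right (by positivity) ?_)
    rw [Real.norm_eq_abs, abs_le]
    constructor <;> linarith [hs.1, hs.2]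
  have hθ₂' : (θ : ℝ) ≤ 1 / 2 := by exact_mod_cast hθ₂
  have hvm : ‖v m‖ ≤ 2 * ‖v 1‖ := by
    nlinarith [hθ₂', hsub m hm, norm_le_norm_add_norm_sub' (v m) (v 1), norm_nonneg (v m)]
  calc ‖v t - v 1‖ ≤ θ * ‖v m‖ := hsub t ht
    _ ≤ θ * (2 * ‖v 1‖) := by gcongr
    _ = 2 * θ * ‖v 1‖ := by ring

lemma exists_linear_equation_solution [CompleteSpace E] (hA : ContinuousOn A (Icc 0 1))
    (hθ : ∀ t ∈ Icc (0 : ℝ) 1, ‖A t‖ ≤ θ) (hθ₂ : θ ≤ 1 / 2) (v₁ : E) :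
    ∃ v : ℝ → E, v 1 = v₁ ∧
      ∀ t ∈ Icc (0 : ℝ) 1, HasDerivWithinAt v (-(A t (v t))) (Icc 0 1) t := by
  have hf : IsPicardLindelof (fun t v => -(A t v)) (⟨1, by simp⟩ : Icc (0 : ℝ) 1) v₁
      ‖v₁‖₊ 0 ‖v₁‖₊ θ :=
    { lipschitzOnWith := fun t ht =>
        ((A t).lipschitz.weaken (hθ t ht)).neg.lipschitzOnWith
      continuousOn := fun v _ => (hA.clm_apply continuousOn_const).neg
      norm_le := fun t ht v hv => by
        have hv' : ‖v‖ ≤ ‖v₁‖ + ‖v₁‖ := norm_le_norm_add_const_of_dist_le hv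
        have hθ₂' : (θ : ℝ) ≤ 1 / 2 := by exact_mod_cast hθ₂
        calc ‖-(A t v)‖ = ‖A t v‖ := norm_neg _
          _ ≤ θ * (‖v₁‖ + ‖v₁‖) := (A t).le_of_opNorm_le_of_le (hθ t ht) hv'
          _ ≤ 1 / 2 * (‖v₁‖ + ‖v₁‖) := by gcongr
          _ = ‖v₁‖ := by ring
      mul_max_le := by simp }
  exact hf.exists_eq_forall_mem_Icc_hasDerivWithinAt₀

end LinearEquation

section Cutoff

variable {E F : Type*} [NormedAddCommGroup E] [NormedSpace ℝ E] [FiniteDimensional ℝ E]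
  [NormedAddCommGroup F] [NormedSpace ℝ F]

lemma exists_lipschitzWith_bounded_eventuallyEq {f : E → F} {x : E} (hf : ContDiffAt ℝ 1 f x) :
    ∃ (g : E → F) (K C : ℝ≥0), LipschitzWith K g ∧ (∀ z, ‖g z‖ ≤ C) ∧ g =ᶠ[𝓝 x] f := by
  obtain ⟨r, hr, hball⟩ := Metric.eventually_nhds_iff_ball.1 (hf.eventually (by simp))
  let χ : ContDiffBump x := ⟨r / 4, r / 2, by positivity, by linarith⟩
  have hg : ContDiff ℝ 1 fun z => χ z • f z := by
    refine contDiff_iff_contDiffAt.2 fun z => ?_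
    by_cases hz : z ∈ Metric.ball x r
    · exact χ.contDiffAt.smul (hball z hz)
    · refine contDiffAt_const (c := 0) |>.congr_of_eventuallyEq ?_
      have hz' : z ∉ Metric.closedBall x (r / 2) := fun h =>
        hz (Metric.closedBall_subset_ball (by linarith) h)
      filter_upwards [Metric.isClosed_closedBall.isOpen_compl.mem_nhds hz'] with y hy
      rw [χ.zero_of_le_dist (not_le.1 fun h => hy (Metric.mem_closedBall.2 h)).le, zero_smul]
  have hsupp : HasCompactSupport fun z => χ z • f z := χ.hasCompactSupport.smul_right
  obtain ⟨K, hK⟩ := ContDiff.lipschitzWith_of_hasCompactSupport hsupp hg (by simp)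
  obtain ⟨C, hC⟩ := hsupp.exists_bound_of_continuous hg.continuous
  refine ⟨_, K, C.toNNReal, hK, fun z => (hC z).trans (Real.le_coe_toNNReal C), ?_⟩
  filter_upwards [χ.eventuallyEq_one] with z hz
  rw [hz]
  exact one_smul ℝ (f z)

end Cutoff

section LipschitzGerms

variable {α β : Type*} [PseudoEMetricSpace α] [PseudoEMetricSpace β]

lemma exists_lipschitzOnWith_of_eventually {f : α → β} {x : α} {K : ℝ≥0}
    (h : ∀ᶠ q in 𝓝 (x, x), edist (f q.1) (f q.2) ≤ K * edist q.1 q.2) :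
    ∃ U ∈ 𝓝 x, LipschitzOnWith K f U := by
  rw [nhds_prod_eq] at h
  obtain ⟨U, hU, hUU⟩ := mem_prod_self_iff.1 h
  exact ⟨U, hU, fun a ha b hb => hUU (mk_mem_prod ha hb)⟩

lemma exists_lipschitzOnWith_clm_apply {E F G : Type*} [NormedAddCommGroup E] [NormedSpace ℝ E]
    [NormedAddCommGroup F] [NormedSpace ℝ F] [NormedAddCommGroup G] [NormedSpace ℝ G]
    {A : G → E →L[ℝ] F} {v : G → E} {x : G}
    (hA : ∃ K, ∃ U ∈ 𝓝 x, LipschitzOnWith K A U) (hv : ∃ K, ∃ U ∈ 𝓝 x, LipschitzOnWith K v U) :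
    ∃ K, ∃ U ∈ 𝓝 x, LipschitzOnWith K (fun z => A z (v z)) U := by
  obtain ⟨KA, UA, hUA, hA⟩ := hA
  obtain ⟨Kv, Uv, hUv, hv⟩ := hv
  have hAc : ContinuousAt A x := hA.continuousOn.continuousAt hUA
  have hvc : ContinuousAt v x := hv.continuousOn.continuousAt hUv
  set a : ℝ≥0 := ‖A x‖₊ + 1
  set b : ℝ≥0 := ‖v x‖₊ + 1
  have ha : ∀ᶠ z in 𝓝 x, ‖A z‖ < a := hAc.norm.eventually (gt_mem_nhds (by simp [a]))
  have hb : ∀ᶠ z in 𝓝 x, ‖v z‖ < b := hvc.norm.eventually (gt_mem_nhds (by simp [b]))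
  refine ⟨KA * b + a * Kv, UA ∩ Uv ∩ {z | ‖A z‖ < a ∧ ‖v z‖ < b},
    inter_mem (inter_mem hUA hUv) (ha.and hb), LipschitzOnWith.of_dist_le_mul fun y hy z hz => ?_⟩
  obtain ⟨⟨hyA, hyv⟩, -, hyb⟩ := hy
  obtain ⟨⟨hzA, hzv⟩, hza, -⟩ := hz
  calc dist (A y (v y)) (A z (v z))
      = ‖(A y - A z) (v y) + A z (v y - v z)‖ := by simp [dist_eq_norm]
    _ ≤ ‖A y - A z‖ * ‖v y‖ + ‖A z‖ * ‖v y - v z‖ :=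
        (norm_add_le _ _).trans
          (add_le_add (ContinuousLinearMap.le_opNorm _ _) (ContinuousLinearMap.le_opNorm _ _))
    _ ≤ (KA * dist y z) * b + a * (Kv * dist y z) := by
        rw [← dist_eq_norm, ← dist_eq_norm]
        have := hA.dist_le_mul y hyA z hzA
        have := hv.dist_le_mul y hyv z hzv
        gcongr
    _ = (KA * b + a * Kv : ℝ≥0) * dist y z := by push_cast; ring

end LipschitzGerms

variable {E : Type*} [NormedAddCommGroup E] [NormedSpace ℝ E]
  {M : Type*} [EMetricSpace M] [ChartedSpace E M]

local notation "φ" => extChartAt 𝓘(ℝ, E)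

/-! ### Coordinates -/

noncomputable section Coordinates

/-- The tangent vector at the point with coordinates `z` in the chart around `p` whose coordinates
in this chart are `u`, as a linear function of `u`. -/
def vecAt (p : M) (z : E) : E →L[ℝ] TangentSpace 𝓘(ℝ, E) ((φ p).symm z) :=
  mfderiv 𝓘(ℝ, E) 𝓘(ℝ, E) (φ p).symm z

/-- `chartVec` as a continuous linear map. -/
def chartVecL (p y : M) : TangentSpace 𝓘(ℝ, E) y →L[ℝ] E :=
  mvfderiv 𝓘(ℝ, E) (φ p) y

/-- The vector field `ξ` in the coordinates of the chart around `p`. -/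
def fieldInChart (ξ : ∀ x : M, TangentSpace 𝓘(ℝ, E) x) (p : M) (z : E) : E :=
  chartVecL p ((φ p).symm z) (ξ ((φ p).symm z))

variable {p : M} {z : E}

lemma chart_symm_mem_source (hz : z ∈ (φ p).target) : (φ p).symm z ∈ (chartAt E p).source :=
  extChartAt_source 𝓘(ℝ, E) p ▸ (φ p).map_target hz

lemma tendsto_chart_symm (p : M) : Tendsto (φ p).symm (𝓝 (φ p p)) (𝓝 p) := by
  simpa [ContinuousAt] using continuousAt_extChartAt_symm (I := 𝓘(ℝ, E)) p

section Manifold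

variable [IsManifold 𝓘(ℝ, E) ∞ M]

lemma chartVecL_vecAt (hz : z ∈ (φ p).target) (u : E) :
    chartVecL p ((φ p).symm z) (vecAt p z u) = u := by
  have h := DFunLike.congr_fun
    (mfderiv_extChartAt_comp_mfderivWithin_extChartAt_symm (I := 𝓘(ℝ, E)) hz) u
  simp only [modelWithCornersSelf_coe, range_id, mfderivWithin_univ] at h
  exact h

lemma vecAt_chartVecL (hz : z ∈ (φ p).target) (v : TangentSpace 𝓘(ℝ, E) ((φ p).symm z)) :
    vecAt p z (chartVecL p ((φ p).symm z) v) = v := by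
  have h := DFunLike.congr_fun
    (mfderivWithin_extChartAt_symm_comp_mfderiv_extChartAt (I := 𝓘(ℝ, E)) hz) v
  simp only [modelWithCornersSelf_coe, range_id, mfderivWithin_univ] at h
  exact h

lemma vecAt_fieldInChart (ξ : ∀ x : M, TangentSpace 𝓘(ℝ, E) x) (hz : z ∈ (φ p).target) :
    vecAt p z (fieldInChart ξ p z) = ξ ((φ p).symm z) :=
  vecAt_chartVecL hz _

lemma vecAt_eq_symmL (hz : z ∈ (φ p).target) :
    vecAt p z = (trivializationAt E (TangentSpace 𝓘(ℝ, E)) p).symmL ℝ ((φ p).symm z) := by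
  have h := TangentBundle.symmL_trivializationAt (𝕜 := ℝ) (I := 𝓘(ℝ, E))
    (chart_symm_mem_source hz)
  simp only [modelWithCornersSelf_coe, range_id, mfderivWithin_univ] at h
  rw [(φ p).right_inv hz] at h
  exact h.symm

lemma contMDiffOn_vecAt (p : M) :
    ContMDiffOn 𝓘(ℝ, E × E) 𝓘(ℝ, E).tangent ∞
      (fun q : E × E => (⟨(φ p).symm q.1, vecAt p q.1 q.2⟩ : TangentBundle 𝓘(ℝ, E) M))
      ((φ p).target ×ˢ univ) := by
  have hbase : ∀ q ∈ (φ p).target ×ˢ (univ : Set E),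
      (φ p).symm q.1 ∈ (trivializationAt E (TangentSpace 𝓘(ℝ, E)) p).baseSet := fun q hq => by
    simpa using chart_symm_mem_source hq.1
  refine (Trivialization.contMDiffOn_iff fun q hq =>
    (Trivialization.mem_source _).2 (hbase q hq)).2 ⟨?_, ?_⟩
  · exact (contMDiffOn_extChartAt_symm p).comp contDiff_fst.contMDiff.contMDiffOn fun q hq => hq.1
  · refine ContMDiffOn.congr (f := Prod.snd) contDiff_snd.contMDiff.contMDiffOn fun q hq => ?_
    have h := (trivializationAt E (TangentSpace 𝓘(ℝ, E)) p).apply_mk_symm (hbase q hq) q.2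
    rw [← Trivialization.symmL_apply (R := ℝ) _ (hbase q hq), ← vecAt_eq_symmL hq.1] at h
    exact congrArg Prod.snd h

lemma hasMFDerivAt_chart_symm (hz : z ∈ (φ p).target) :
    HasMFDerivAt 𝓘(ℝ, E) 𝓘(ℝ, E) (φ p).symm z (vecAt p z) :=
  ((contMDiffOn_extChartAt_symm (n := ∞) p).contMDiffAt
    ((isOpen_extChartAt_target p).mem_nhds hz)).mdifferentiableAt (by simp) |>.hasMFDerivAt

lemma hasFDerivAt_comp_chart_symm {f : M → ℝ} (hf : MDifferentiable 𝓘(ℝ, E) 𝓘(ℝ, ℝ) f)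
    (hz : z ∈ (φ p).target) :
    HasFDerivAt (f ∘ (φ p).symm)
      ((mvfderiv 𝓘(ℝ, E) f ((φ p).symm z)).comp (vecAt p z)) z :=
  ((hf _).hasMFDerivAt.comp z (hasMFDerivAt_chart_symm hz)).hasFDerivAt

lemma velocity_chart_symm {c : ℝ → E} {t : ℝ} {u : E} (hc : HasDerivAt c u t)
    (ht : t ∈ Icc (0 : ℝ) 1) (hz : c t ∈ (φ p).target) :
    velocity (E := E) (fun t => (φ p).symm (c t)) t = vecAt p (c t) u := by
  have hderiv := ((hasMFDerivAt_chart_symm hz).comp t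
    hc.hasFDerivAt.hasMFDerivAt).hasMFDerivWithinAt (s := Icc 0 1) |>.mfderivWithin
      (uniqueDiffOn_Icc zero_lt_one t ht).uniqueMDiffWithinAt
  refine (DFunLike.congr_fun hderiv (1 : ℝ)).trans ?_
  change vecAt p (c t) ((1 : ℝ) • u) = _
  rw [one_smul]

end Manifold

section Metric

variable [RiemannianBundle (fun x : M => TangentSpace 𝓘(ℝ, E) x)]

/-- The metric tensor in the chart around `p`, as a continuous bilinear form. -/
def metricForm (p : M) (z : E) : E →L[ℝ] E →L[ℝ] ℝ :=
  (innerSL ℝ).bilinearComp (vecAt p z) (vecAt p z)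

lemma metricForm_apply (p : M) (z u w : E) : metricForm p z u w = chartMetric p z u w := rfl

variable [IsManifold 𝓘(ℝ, E) ∞ M]

lemma isInvertible_metricForm [FiniteDimensional ℝ E] (hz : z ∈ (φ p).target) :
    (metricForm p z).IsInvertible := by
  have hinj : Function.Injective (metricForm p z).toLinearMap := by
    refine LinearMap.ker_eq_bot.1 (LinearMap.ker_eq_bot'.2 fun u hu => ?_)
    have hinner : inner ℝ (vecAt p z u) (vecAt p z u) = 0 :=
      DFunLike.congr_fun (show metricForm p z u = 0 from hu) u
    rw [← chartVecL_vecAt hz u, inner_self_eq_zero.1 hinner, map_zero]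
  have hfin : Module.finrank ℝ E = Module.finrank ℝ (E →L[ℝ] ℝ) :=
    Subspace.dual_finrank_eq.symm.trans
      (LinearMap.toContinuousLinearMap (𝕜 := ℝ) (E := E) (F' := ℝ)).finrank_eq
  exact ⟨(LinearEquiv.ofInjectiveOfFinrankEq _ hinj hfin).toContinuousLinearEquiv, rfl⟩

variable [IsContMDiffRiemannianBundle 𝓘(ℝ, E) ∞ E (fun x : M => TangentSpace 𝓘(ℝ, E) x)]

variable (E M) in
lemma isContinuousRiemannianBundle_tangentSpace :
    IsContinuousRiemannianBundle E (fun x : M => TangentSpace 𝓘(ℝ, E) x) := by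
  obtain ⟨g, hg, h⟩ := IsContMDiffRiemannianBundle.exists_contMDiff (IB := 𝓘(ℝ, E)) (n := ∞)
    (F := E) (E := fun x : M => TangentSpace 𝓘(ℝ, E) x)
  exact ⟨g, hg.continuous, h⟩

lemma exists_norm_vecAt_le (p : M) :
    ∃ C : ℝ≥0, ∀ᶠ z in 𝓝 (φ p p), ∀ u, ‖vecAt p z u‖ ≤ C * ‖u‖ := by
  have := isContinuousRiemannianBundle_tangentSpace E M
  obtain ⟨C, hC, h⟩ := eventually_norm_symmL_trivializationAt_lt E
    (fun x : M => TangentSpace 𝓘(ℝ, E) x) p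
  refine ⟨⟨C, hC.le⟩, ?_⟩
  filter_upwards [(tendsto_chart_symm p).eventually h,
    extChartAt_target_mem_nhds (I := 𝓘(ℝ, E)) p] with z h hz u
  rw [vecAt_eq_symmL hz]
  exact (ContinuousLinearMap.le_opNorm _ _).trans (by gcongr; exact h.le)

lemma exists_norm_metricForm_le (p : M) :
    ∃ C : ℝ≥0, ∀ᶠ z in 𝓝 (φ p p), ∀ v, ‖metricForm p z v‖ ≤ C * ‖v‖ := by
  obtain ⟨C, hC⟩ := exists_norm_vecAt_le (E := E) p
  refine ⟨C ^ 2, hC.mono fun z hz v => ContinuousLinearMap.opNorm_le_bound _ (by positivity)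
    fun u => ?_⟩
  calc ‖metricForm p z v u‖ ≤ ‖vecAt p z v‖ * ‖vecAt p z u‖ :=
        abs_real_inner_le_norm (vecAt p z v) (vecAt p z u)
    _ ≤ (C * ‖v‖) * (C * ‖u‖) := by gcongr <;> exact hz _
    _ = (C ^ 2 : ℝ≥0) * ‖v‖ * ‖u‖ := by push_cast; ring

lemma exists_norm_chartVecL_le (p : M) :
    ∃ C : ℝ≥0, ∀ᶠ y in 𝓝 p, ∀ v : TangentSpace 𝓘(ℝ, E) y, ‖chartVecL p y v‖ ≤ C * ‖v‖ := by
  have := isContinuousRiemannianBundle_tangentSpace E M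
  obtain ⟨C, hC, h⟩ := eventually_norm_trivializationAt_lt E
    (fun x : M => TangentSpace 𝓘(ℝ, E) x) p
  refine ⟨⟨C, hC.le⟩, ?_⟩
  filter_upwards [h, chart_source_mem_nhds E p] with y h hy v
  have heq : chartVecL p y v
      = (trivializationAt E (TangentSpace 𝓘(ℝ, E)) p).continuousLinearMapAt ℝ y v :=
    DFunLike.congr_fun
      (TangentBundle.continuousLinearMapAt_trivializationAt (𝕜 := ℝ) (I := 𝓘(ℝ, E)) hy).symm v
  rw [heq]
  exact (ContinuousLinearMap.le_opNorm _ _).trans (by gcongr; exact h.le)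

lemma exists_lipschitzOnWith_chart_symm [IsRiemannianManifold 𝓘(ℝ, E) M] (p : M) :
    ∃ C, ∃ U ∈ 𝓝 (φ p p), LipschitzOnWith C (φ p).symm U := by
  obtain ⟨C, hC⟩ := exists_norm_vecAt_le (E := E) p
  obtain ⟨δ, hδ, hball⟩ := Metric.eventually_nhds_iff_ball.1
    (hC.and (extChartAt_target_mem_nhds (I := 𝓘(ℝ, E)) p))
  refine ⟨C, Metric.ball (φ p p) δ, Metric.ball_mem_nhds _ hδ, fun z₁ h₁ z₂ h₂ => ?_⟩
  let c : ℝ → E := AffineMap.lineMap z₁ z₂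
  have hc : ∀ t ∈ Icc (0 : ℝ) 1, c t ∈ Metric.ball (φ p p) δ := fun t ht =>
    (convex_ball _ _).lineMap_mem h₁ h₂ ht
  have hcdiff : ContDiff ℝ 1 c := (ContinuousAffineMap.lineMap (R := ℝ) z₁ z₂).contDiff
  rw [IsRiemannianManifold.out (I := 𝓘(ℝ, E))]
  calc Manifold.riemannianEDist 𝓘(ℝ, E) ((φ p).symm z₁) ((φ p).symm z₂)
      ≤ Manifold.pathELength 𝓘(ℝ, E) (fun t => (φ p).symm (c t)) 0 1 :=
        Manifold.riemannianEDist_le_pathELength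
          ((contMDiffOn_extChartAt_symm p).comp hcdiff.contMDiff.contMDiffOn
            fun t ht => (hball _ (hc t ht)).2) (by simp [c]) (by simp [c]) zero_le_one
    _ ≤ ∫⁻ _ in Icc (0 : ℝ) 1, C * edist z₁ z₂ := by
        rw [Manifold.pathELength_eq_lintegral_mfderivWithin_Icc]
        refine MeasureTheory.setLIntegral_mono' measurableSet_Icc fun t ht => ?_
        obtain ⟨hnorm, htarget⟩ := hball _ (hc t ht)
        have hle := hnorm (z₂ - z₁)
        rw [← velocity_chart_symm (p := p) (c := c) AffineMap.hasDerivAt_lineMap ht htarget] at hle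
        rw [edist_comm, edist_eq_enorm_sub, ← ofReal_norm, ← ofReal_norm,
          ← ENNReal.ofReal_coe_nnreal, ← ENNReal.ofReal_mul C.coe_nonneg]
        exact ENNReal.ofReal_le_ofReal hle
    _ = C * edist z₁ z₂ := by simp

variable [FiniteDimensional ℝ E]

lemma contDiffOn_metricForm (p : M) : ContDiffOn ℝ ∞ (metricForm p) (φ p).target := by
  refine contDiffOn_clm_apply.2 fun u => contDiffOn_clm_apply.2 fun w =>
    contMDiffOn_iff_contDiffOn.1 ?_
  have hvec : ∀ u : E, ContMDiffOn 𝓘(ℝ, E) 𝓘(ℝ, E).tangent ∞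
      (fun z : E => (⟨(φ p).symm z, vecAt p z u⟩ : TangentBundle 𝓘(ℝ, E) M)) (φ p).target :=
    fun u => (contMDiffOn_vecAt p).comp (f := fun z : E => (z, u))
      (contDiff_prodMk_left u).contMDiff.contMDiffOn fun z hz => ⟨hz, mem_univ _⟩
  exact ContMDiffOn.inner_bundle (E := fun x : M => TangentSpace 𝓘(ℝ, E) x)
    (b := (φ p).symm) (v := fun z => vecAt p z u) (w := fun z => vecAt p z w) (hvec u) (hvec w)

lemma fderiv_metricForm_apply (hz : z ∈ (φ p).target) (a u w : E) :
    fderiv ℝ (metricForm p) z a u w = fderiv ℝ (fun z => chartMetric p z u w) z a := by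
  have hd : HasFDerivAt (metricForm p) (fderiv ℝ (metricForm p) z) z :=
    (((contDiffOn_metricForm p).contDiffAt ((isOpen_extChartAt_target p).mem_nhds hz))
      |>.differentiableAt (by simp)).hasFDerivAt
  have h := (hd.clm_apply (hasFDerivAt_const u z)).clm_apply (hasFDerivAt_const w z)
  simp only [metricForm_apply] at h
  rw [h.fderiv]
  simp

end Metric

section Christoffel

variable [RiemannianBundle (fun x : M => TangentSpace 𝓘(ℝ, E) x)]

set_option maxSynthPendingDepth 3 in
/-- The Christoffel symbols of the first kind in the chart around `p`, as a continuous trilinear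
form. -/
def christoffelForm (p : M) (z : E) : E →L[ℝ] E →L[ℝ] E →L[ℝ] ℝ :=
  let D := fderiv ℝ (metricForm p) z
  (2⁻¹ : ℝ) • (D + D.flip -
    (ContinuousLinearMap.flipₗᵢ ℝ E E ℝ).toContinuousLinearEquiv.toContinuousLinearMap ∘L D.flip)

/-- The Christoffel symbols of the second kind in the chart around `p`. -/
def christoffelMap (p : M) (z : E) : E →L[ℝ] E →L[ℝ] E :=
  ContinuousLinearMap.compL ℝ E (E →L[ℝ] ℝ) E (metricForm p z).inverse ∘L christoffelForm p z

variable [FiniteDimensional ℝ E] [IsManifold 𝓘(ℝ, E) ∞ M]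
  [IsContMDiffRiemannianBundle 𝓘(ℝ, E) ∞ E (fun x : M => TangentSpace 𝓘(ℝ, E) x)]

set_option maxSynthPendingDepth 3 in
lemma christoffelForm_apply (hz : z ∈ (φ p).target) (a b w : E) :
    christoffelForm p z a b w = christoffel p z a b w := by
  have h : christoffelForm p z a b w = 2⁻¹ * (fderiv ℝ (metricForm p) z a b w
    + fderiv ℝ (metricForm p) z b a w - fderiv ℝ (metricForm p) z w a b) := rfl
  simp only [h, fderiv_metricForm_apply hz, christoffel]
  ring

lemma chartMetric_christoffelMap (hz : z ∈ (φ p).target) (a b w : E) :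
    chartMetric p z (christoffelMap p z a b) w = christoffel p z a b w := by
  have h : christoffelMap p z a b = (metricForm p z).inverse (christoffelForm p z a b) := rfl
  rw [← metricForm_apply, ← christoffelForm_apply hz, h]
  obtain ⟨e, he⟩ := isInvertible_metricForm hz
  simp [← he]

lemma contDiffOn_christoffel (p : M) (a b w : E) :
    ContDiffOn ℝ 1 (fun z => christoffel p z a b w) (φ p).target := by
  have hD (a u w : E) :
      ContDiffOn ℝ 1 (fun z => fderiv ℝ (fun z' => chartMetric p z' u w) z a) (φ p).target :=
    (((contDiffOn_metricForm p).clm_apply contDiffOn_const).clm_apply contDiffOn_const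
      |>.fderiv_of_isOpen (isOpen_extChartAt_target p)
        (by norm_num; exact WithTop.coe_le_coe.2 le_top)).clm_apply contDiffOn_const
  exact (((hD a b w).add (hD b a w)).sub (hD w a b)).div_const 2

lemma contDiffOn_christoffelMap (p : M) : ContDiffOn ℝ 1 (christoffelMap p) (φ p).target := by
  have hinv : ContDiffOn ℝ 1 (fun z => (metricForm p z).inverse) (φ p).target := fun z hz =>
    (isInvertible_metricForm hz).contDiffAt_map_inverse.comp_contDiffWithinAt z
      ((contDiffOn_metricForm p z hz).of_le (by simp))
  refine contDiffOn_clm_apply.2 fun a => contDiffOn_clm_apply.2 fun b =>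
    hinv.clm_apply (contDiffOn_clm_apply.2 fun w => ?_)
  exact (contDiffOn_christoffel p a b w).congr fun z hz => christoffelForm_apply hz a b w

end Christoffel
end Coordinates

/-! ### Geodesics and locally Lipschitz gradients -/

section Geodesics

variable [RiemannianBundle (fun x : M => TangentSpace 𝓘(ℝ, E) x)] {p : M} {c u v : ℝ → E}

lemma isParallel_congr {γ : ℝ → M} {W W' : ∀ t, TangentSpace 𝓘(ℝ, E) (γ t)}
    (h : IsParallel γ W) (heq : ∀ t ∈ Icc (0 : ℝ) 1, W' t = W t) : IsParallel γ W' := by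
  intro t ht
  obtain ⟨p, hp, v', hv', hΓ⟩ := h t ht
  refine ⟨p, hp, v', hv'.congr (fun s hs => by rw [heq s hs]) (by rw [heq t ht]), ?_⟩
  rwa [heq t ht]

/-- The curve `c`, with velocity `u`, solves the geodesic equation in the chart around `p` on
`[0, 1]`. -/
structure IsChartGeodesic (p : M) (c u : ℝ → E) : Prop where
  continuous_velocity : Continuous u
  hasDerivAt : ∀ t, HasDerivAt c (u t) t
  mem_target : ∀ t ∈ Icc (0 : ℝ) 1, c t ∈ (φ p).target
  equation : ∀ t ∈ Icc (0 : ℝ) 1,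
    HasDerivWithinAt u (-(christoffelMap p (c t) (u t) (u t))) (Icc 0 1) t

namespace IsChartGeodesic

lemma contDiff (hc : IsChartGeodesic p c u) : ContDiff ℝ 1 c := by
  refine contDiff_one_iff_deriv.2 ⟨fun t => (hc.hasDerivAt t).differentiableAt, ?_⟩
  rw [funext fun t => (hc.hasDerivAt t).deriv]
  exact hc.continuous_velocity

variable [FiniteDimensional ℝ E] [IsManifold 𝓘(ℝ, E) ∞ M]
  [IsContMDiffRiemannianBundle 𝓘(ℝ, E) ∞ E (fun x : M => TangentSpace 𝓘(ℝ, E) x)]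

lemma isParallel (hc : IsChartGeodesic p c u)
    (hv : ∀ t ∈ Icc (0 : ℝ) 1,
      HasDerivWithinAt v (-(christoffelMap p (c t) (u t) (v t))) (Icc 0 1) t) :
    IsParallel (fun t => (φ p).symm (c t)) (fun t => vecAt p (c t) (v t)) := by
  have hcoord : ∀ w : ℝ → E, ∀ t ∈ Icc (0 : ℝ) 1,
      chartVec p ((φ p).symm (c t)) (vecAt p (c t) (w t)) = w t :=
    fun w t ht => chartVecL_vecAt (hc.mem_target t ht) (w t)
  intro t ht
  have hz := hc.mem_target t ht
  refine ⟨p, chart_symm_mem_source hz, _, (hv t ht).congr (hcoord v) (hcoord v t ht), fun w => ?_⟩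
  simp only [velocity_chart_symm (hc.hasDerivAt t) ht hz, hcoord u t ht, hcoord v t ht,
    (φ p).right_inv hz]
  rw [← chartMetric_christoffelMap hz, ← metricForm_apply, ← metricForm_apply, map_neg]
  simp

lemma isGeodesic (hc : IsChartGeodesic p c u) :
    IsGeodesic E (fun t => (φ p).symm (c t)) :=
  ⟨(contMDiffOn_extChartAt_symm p).comp hc.contDiff.contMDiff.contMDiffOn hc.mem_target,
    isParallel_congr (hc.isParallel hc.equation) fun t ht =>
      velocity_chart_symm (hc.hasDerivAt t) ht (hc.mem_target t ht)⟩

lemma exists_parallel (hc : IsChartGeodesic p c u) {θ : ℝ≥0}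
    (hθ : ∀ t ∈ Icc (0 : ℝ) 1, ‖christoffelMap p (c t) (u t)‖ ≤ θ) (hθ₂ : (θ : ℝ) ≤ 1 / 2) (w : E) :
    ∃ v : ℝ → E, v 1 = w ∧ ‖v 0 - w‖ ≤ 2 * θ * ‖w‖ ∧ ∀ t ∈ Icc (0 : ℝ) 1,
      HasDerivWithinAt v (-(christoffelMap p (c t) (u t) (v t))) (Icc 0 1) t := by
  have hA : ContinuousOn (fun t => christoffelMap p (c t) (u t)) (Icc 0 1) :=
    ((contDiffOn_christoffelMap p).continuousOn.comp hc.contDiff.continuous.continuousOn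
      hc.mem_target).clm_apply hc.continuous_velocity.continuousOn
  obtain ⟨v, rfl, hv⟩ := exists_linear_equation_solution hA hθ hθ₂ w
  exact ⟨v, rfl, norm_sub_le_of_linear_equation hθ hθ₂ hv (left_mem_Icc.2 zero_le_one), hv⟩

end IsChartGeodesic

variable [FiniteDimensional ℝ E] [IsManifold 𝓘(ℝ, E) ∞ M]
  [IsContMDiffRiemannianBundle 𝓘(ℝ, E) ∞ E (fun x : M => TangentSpace 𝓘(ℝ, E) x)]

lemma eventually_exists_isChartGeodesic {U : Set E} (hU : U ∈ 𝓝 (φ p p)) :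
    ∀ᶠ q in 𝓝 (φ p p, φ p p), ∃ c u : ℝ → E, IsChartGeodesic p c u ∧ c 0 = q.1 ∧ c 1 = q.2 ∧
      ∀ t ∈ Icc (0 : ℝ) 1, c t ∈ U ∧ ‖u t‖ ≤ 2 * ‖q.2 - q.1‖ := by
  have htarget := extChartAt_target_mem_nhds (I := 𝓘(ℝ, E)) p
  obtain ⟨Γ, K, C, hK, hC, heq⟩ := exists_lipschitzWith_bounded_eventuallyEq
    ((contDiffOn_christoffelMap p).contDiffAt htarget)
  obtain ⟨r, hr, hball⟩ := Metric.eventually_nhds_iff_ball.1 (heq.and (inter_mem hU htarget))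
  have hsmall : ∀ᶠ q : E × E in 𝓝 (φ p p, φ p p),
      16 * (K + C) * (2 * ‖q.2 - q.1‖) + 2 * ‖q.2 - q.1‖ < 2 :=
    (Continuous.tendsto' (by fun_prop) _ 0 (by simp)).eventually_lt_const two_pos
  have hnear : ∀ᶠ q : E × E in 𝓝 (φ p p, φ p p), 2 * ‖q.2 - q.1‖ + ‖q.1 - φ p p‖ < r :=
    (Continuous.tendsto' (by fun_prop) _ 0 (by simp)).eventually_lt_const hr
  filter_upwards [hsmall, hnear] with q hsmall hnear
  have hN : LipschitzOnWith (1 / 4) (fun z : E × E => -(Γ z.1 z.2 z.2))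
      (univ ×ˢ Metric.closedBall 0 (2 * ‖q.2 - q.1‖)) := by
    simpa using lipschitzOnWith_quadratic hK hC (ρ := 2 * ‖q.2 - q.1‖₊)
      (by exact_mod_cast hsmall.le)
  obtain ⟨c, u, hc₀, hc₁, hu, hcu, hu_le, hgeo⟩ := exists_twoPoint_solution
    (((hK.continuous.comp continuous_fst).clm_apply continuous_snd).clm_apply continuous_snd).neg
    (by simp) hN
  have hmem : ∀ t ∈ Icc (0 : ℝ) 1, c t ∈ Metric.ball (φ p p) r := by
    intro t ht
    have hle : ‖c t - c 0‖ ≤ 2 * ‖q.2 - q.1‖ * (t - 0) :=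
      norm_image_sub_le_of_norm_deriv_le_segment' (fun s _ => (hcu s).hasDerivWithinAt)
        (fun s _ => hu_le s) t ht
    rw [mem_ball_iff_norm]
    calc ‖c t - φ p p‖ ≤ ‖c t - q.1‖ + ‖q.1 - φ p p‖ := norm_sub_le_norm_sub_add_norm_sub _ _ _
      _ ≤ 2 * ‖q.2 - q.1‖ + ‖q.1 - φ p p‖ := by
        rw [← hc₀]
        gcongr
        rw [hc₀] at hle ⊢
        exact hle.trans (mul_le_of_le_one_right (by positivity) (by linarith [ht.2]))
      _ < r := hnear
  refine ⟨c, u, ⟨hu, hcu, fun t ht => (hball _ (hmem t ht)).2.2, fun t ht => ?_⟩, hc₀, hc₁,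
    fun t ht => ⟨(hball _ (hmem t ht)).2.1, hu_le t⟩⟩
  rw [← (hball _ (hmem t ht)).1]
  exact hgeo t ht

lemma exists_chart_bounds (p : M) :
    ∃ C : ℝ≥0, ∀ᶠ z in 𝓝 (φ p p), (∀ u, ‖vecAt p z u‖ ≤ C * ‖u‖) ∧
      (∀ v : TangentSpace 𝓘(ℝ, E) ((φ p).symm z), ‖chartVecL p ((φ p).symm z) v‖ ≤ C * ‖v‖) ∧
      ‖christoffelMap p z‖ ≤ C := by
  obtain ⟨C₁, h₁⟩ := exists_norm_vecAt_le (E := E) p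
  obtain ⟨C₂, h₂⟩ := exists_norm_chartVecL_le (E := E) p
  obtain ⟨Γ, -, C₃, -, h₃, heq⟩ := exists_lipschitzWith_bounded_eventuallyEq
    ((contDiffOn_christoffelMap p).contDiffAt (extChartAt_target_mem_nhds (I := 𝓘(ℝ, E)) p))
  refine ⟨C₁ + C₂ + C₃, ?_⟩
  filter_upwards [h₁, (tendsto_chart_symm p).eventually h₂, heq] with z h₁ h₂ heq
  refine ⟨fun u => (h₁ u).trans ?_, fun v => (h₂ v).trans ?_, ?_⟩
  · gcongr
    exact_mod_cast le_add_right (le_add_right le_rfl)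
  · gcongr
    exact_mod_cast le_add_right (le_add_left le_rfl)
  · rw [← heq]
    exact (h₃ z).trans (by exact_mod_cast le_add_left le_rfl)

variable [IsRiemannianManifold 𝓘(ℝ, E) M] {ξ : ∀ x : M, TangentSpace 𝓘(ℝ, E) x}

lemma exists_norm_vecAt_sub_le (hξ : IsLocallyLipschitzField ξ) (p : M) :
    ∃ C : ℝ≥0, ∀ᶠ q in 𝓝 (φ p p, φ p p), ∃ v : E,
      ‖vecAt p q.1 v - ξ ((φ p).symm q.1)‖ ≤ C * ‖q.2 - q.1‖ ∧
      ‖v - fieldInChart ξ p q.2‖ ≤ C * ‖q.2 - q.1‖ * ‖fieldInChart ξ p q.2‖ := by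
  have := Manifold.locallyCompact_of_finiteDimensional (M := M) 𝓘(ℝ, E)
  obtain ⟨K, hK, hKp⟩ := exists_compact_mem_nhds p
  obtain ⟨r, hr, L, hL⟩ := hξ K hK
  obtain ⟨C, hC⟩ := exists_chart_bounds (E := E) p
  obtain ⟨Ce, Ue, hUe, hCe⟩ := exists_lipschitzOnWith_chart_symm (E := E) p
  have hsmall (b : ℝ) (hb : 0 < b) :
      ∀ᶠ q : E × E in 𝓝 (φ p p, φ p p), C * (2 * ‖q.2 - q.1‖) < b :=
    (Continuous.tendsto' (by fun_prop) _ 0 (by simp)).eventually_lt_const hb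
  refine ⟨L * Ce + 4 * C, ?_⟩
  filter_upwards [eventually_exists_isChartGeodesic (inter_mem (inter_mem hUe
    ((tendsto_chart_symm p).eventually_mem hKp)) hC), hsmall (1 / 2) (by norm_num), hsmall r hr]
    with ⟨z₁, z₂⟩ ⟨c, u, hc, hc₀, hc₁, hcu⟩ hθ hvel
  obtain rfl : c 0 = z₁ := hc₀
  obtain rfl : c 1 = z₂ := hc₁
  dsimp only at hcu hθ hvel ⊢
  have h0 : (0 : ℝ) ∈ Icc (0 : ℝ) 1 := left_mem_Icc.2 zero_le_one
  have h1 : (1 : ℝ) ∈ Icc (0 : ℝ) 1 := right_mem_Icc.2 zero_le_one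
  obtain ⟨v, hv₁, hv₀, hv⟩ := hc.exists_parallel (θ := C * (2 * ‖c 1 - c 0‖₊))
    (fun t ht => ContinuousLinearMap.le_of_opNorm_le_of_le _ (hcu t ht).1.2.2.2 (hcu t ht).2)
    (by exact_mod_cast hθ.le) (fieldInChart ξ p (c 1))
  have htransport : ‖vecAt p (c 0) (v 0) - ξ ((φ p).symm (c 0))‖ₑ ≤
      L * (Ce * edist (c 0) (c 1)) := by
    refine (hL _ hc.isGeodesic (hcu 0 h0).1.1.2 (hcu 1 h1).1.1.2 ?_ _ (hc.isParallel hv) ?_).trans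
      (by gcongr; exact hCe (hcu 0 h0).1.1.1 (hcu 1 h1).1.1.1)
    · rw [velocity_chart_symm (hc.hasDerivAt 0) h0 (hc.mem_target 0 h0)]
      exact (((hcu 0 h0).1.2.1 _).trans (by gcongr; exact (hcu 0 h0).2)).trans_lt hvel
    · rw [hv₁, vecAt_fieldInChart ξ (hc.mem_target 1 h1)]
  rw [edist_comm, edist_eq_enorm_sub, ← mul_assoc, enorm_eq_nnnorm, enorm_eq_nnnorm] at htransport
  refine ⟨v 0, ?_, hv₀.trans ?_⟩
  · calc _ ≤ (L * Ce : ℝ≥0) * ‖c 1 - c 0‖ := by exact_mod_cast htransport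
      _ ≤ _ := by
        gcongr
        exact le_self_add
  · calc _ = (4 * C : ℝ≥0) * ‖c 1 - c 0‖ * ‖fieldInChart ξ p (c 1)‖ := by push_cast; ring
      _ ≤ _ := by
        gcongr
        exact le_add_self

lemma exists_transport_estimate (hξ : IsLocallyLipschitzField ξ) (p : M) :
    ∃ C : ℝ≥0, ∀ᶠ q in 𝓝 (φ p p, φ p p), ∃ v : E,
      ‖v - fieldInChart ξ p q.1‖ ≤ C * ‖q.2 - q.1‖ ∧
      ‖v - fieldInChart ξ p q.2‖ ≤ C * ‖q.2 - q.1‖ * ‖fieldInChart ξ p q.2‖ := by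
  obtain ⟨C, hC⟩ := exists_norm_vecAt_sub_le hξ p
  obtain ⟨Cv, hCv⟩ := exists_norm_chartVecL_le (E := E) p
  refine ⟨max (Cv * C) C, ?_⟩
  filter_upwards [hC, continuousAt_fst.eventually ((tendsto_chart_symm p).eventually hCv),
    continuousAt_fst.eventually (extChartAt_target_mem_nhds (I := 𝓘(ℝ, E)) p)]
    with q ⟨v, h₁, h₂⟩ hv hq
  refine ⟨v, ?_, h₂.trans (by gcongr; exact le_max_right _ _)⟩
  calc ‖v - fieldInChart ξ p q.1‖
      = ‖chartVecL p ((φ p).symm q.1) (vecAt p q.1 v - ξ ((φ p).symm q.1))‖ := by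
        rw [map_sub, chartVecL_vecAt hq, fieldInChart]
    _ ≤ Cv * (C * ‖q.2 - q.1‖) := (hv _).trans (by gcongr)
    _ = (Cv * C : ℝ≥0) * ‖q.2 - q.1‖ := by rw [NNReal.coe_mul, mul_assoc]
    _ ≤ _ := by
      gcongr
      exact le_max_left _ _

/-- Local boundedness comes first, from the estimates with one end point at the centre of the
chart. -/
lemma exists_lipschitzOnWith_fieldInChart (hξ : IsLocallyLipschitzField ξ) (p : M) :
    ∃ K, ∃ U ∈ 𝓝 (φ p p), LipschitzOnWith K (fieldInChart ξ p) U := by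
  obtain ⟨C, hC⟩ := exists_transport_estimate hξ p
  have hbdd : ∀ᶠ z in 𝓝 (φ p p),
      ‖fieldInChart ξ p z‖ ≤ 2 * (‖fieldInChart ξ p (φ p p)‖ + 1) := by
    have hsmall : ∀ᶠ z in 𝓝 (φ p p), C * ‖z - φ p p‖ < 1 / 2 :=
      (Continuous.tendsto' (by fun_prop) _ 0 (by simp)).eventually_lt_const (by norm_num)
    filter_upwards [(Continuous.prodMk_right (φ p p)).continuousAt.eventually hC, hsmall]
      with z ⟨v, h₁, h₂⟩ hsmall
    have h₃ := norm_le_norm_add_norm_sub v (fieldInChart ξ p z)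
    have h₄ := norm_le_norm_add_norm_sub' v (fieldInChart ξ p (φ p p))
    nlinarith [norm_nonneg (fieldInChart ξ p z)]
  refine ⟨C + C * (2 * (‖fieldInChart ξ p (φ p p)‖₊ + 1)), exists_lipschitzOnWith_of_eventually ?_⟩
  filter_upwards [hC, (continuous_snd.tendsto (φ p p, φ p p)).eventually hbdd]
    with q ⟨v, h₁, h₂⟩ hq
  suffices dist (fieldInChart ξ p q.1) (fieldInChart ξ p q.2)
      ≤ (C + C * (2 * (‖fieldInChart ξ p (φ p p)‖ + 1))) * dist q.1 q.2 by
    rw [edist_nndist, edist_nndist]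
    exact_mod_cast this
  rw [dist_eq_norm, dist_eq_norm, norm_sub_rev q.1, add_mul]
  calc _ ≤ ‖fieldInChart ξ p q.1 - v‖ + ‖v - fieldInChart ξ p q.2‖ :=
        norm_sub_le_norm_sub_add_norm_sub _ _ _
    _ ≤ C * ‖q.2 - q.1‖ + C * ‖q.2 - q.1‖ * ‖fieldInChart ξ p q.2‖ := by
        rw [norm_sub_rev]
        gcongr
    _ ≤ C * ‖q.2 - q.1‖
        + C * ‖q.2 - q.1‖ * (2 * (‖fieldInChart ξ p (φ p p)‖ + 1)) := by gcongr
    _ = _ := by ring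

end Geodesics

section Differential

variable [FiniteDimensional ℝ E] [IsManifold 𝓘(ℝ, E) ∞ M]
  [RiemannianBundle (fun x : M => TangentSpace 𝓘(ℝ, E) x)] {f : M → ℝ} {p : M} {z : E}

lemma fderiv_comp_chart_symm_apply (hf : MDifferentiable 𝓘(ℝ, E) 𝓘(ℝ, ℝ) f)
    (hz : z ∈ (φ p).target) (u : E) :
    fderiv ℝ (f ∘ (φ p).symm) z u = inner ℝ (grad f ((φ p).symm z)) (vecAt p z u) := by
  rw [(hasFDerivAt_comp_chart_symm hf hz).fderiv, inner_grad]
  rfl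

lemma fderiv_comp_chart_symm (hf : MDifferentiable 𝓘(ℝ, E) 𝓘(ℝ, ℝ) f) (hz : z ∈ (φ p).target) :
    fderiv ℝ (f ∘ (φ p).symm) z = metricForm p z (fieldInChart (grad f) p z) := by
  ext u
  rw [fderiv_comp_chart_symm_apply hf hz, ← vecAt_fieldInChart (grad f) hz]
  rfl

variable [IsContMDiffRiemannianBundle 𝓘(ℝ, E) ∞ E (fun x : M => TangentSpace 𝓘(ℝ, E) x)]
  [IsRiemannianManifold 𝓘(ℝ, E) M]

lemma exists_lipschitzOnWith_fderiv_comp_chart_symm (hf : IsLocallyLipschitzDifferentiable E f)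
    (p : M) : ∃ K, ∃ U ∈ 𝓝 (φ p p), LipschitzOnWith K (fderiv ℝ (f ∘ (φ p).symm)) U := by
  have htarget := extChartAt_target_mem_nhds (I := 𝓘(ℝ, E)) p
  have hmetric := ((contDiffOn_metricForm p).contDiffAt htarget).of_le (m := 1) (by simp)
  obtain ⟨K, U, hU, hK⟩ := exists_lipschitzOnWith_clm_apply hmetric.exists_lipschitzOnWith
    (exists_lipschitzOnWith_fieldInChart hf.2 p)
  refine ⟨K, U ∩ (φ p).target, inter_mem hU htarget, fun z hz z' hz' => ?_⟩
  rw [fderiv_comp_chart_symm hf.1 hz.2, fderiv_comp_chart_symm hf.1 hz'.2]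
  exact hK hz.1 hz'.1

lemma eventually_hasStrictFDerivAt_comp_chart_symm (hf : IsLocallyLipschitzDifferentiable E f)
    (p : M) : ∀ᶠ z in 𝓝 (φ p p),
      HasStrictFDerivAt (f ∘ (φ p).symm) (fderiv ℝ (f ∘ (φ p).symm) z) z := by
  obtain ⟨K, U, hU, hK⟩ := exists_lipschitzOnWith_fderiv_comp_chart_symm hf p
  filter_upwards [eventually_mem_nhds_iff.2 hU,
    eventually_mem_nhds_iff.2 (extChartAt_target_mem_nhds (I := 𝓘(ℝ, E)) p)] with z hzU hzT
  refine hasStrictFDerivAt_of_hasFDerivAt_of_continuousAt ?_ (hK.continuousOn.continuousAt hzU)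
  filter_upwards [hzT] with z' hz'
  exact (hasFDerivAt_comp_chart_symm hf.1 hz').differentiableAt.hasFDerivAt

end Differential

noncomputable section RetractionInChart

lemma exists_norm_sub_le_snd {X Y Z : Type*} [NormedAddCommGroup X] [NormedSpace ℝ X]
    [NormedAddCommGroup Y] [NormedSpace ℝ Y] [NormedAddCommGroup Z] [NormedSpace ℝ Z]
    {h : X × Y → Z} {z : X} (hh : ContDiffAt ℝ 1 h (z, 0)) :
    ∃ C : ℝ≥0, ∀ᶠ q in 𝓝 (z, (0 : Y)), ‖h q - h (q.1, 0)‖ ≤ C * ‖q.2‖ := by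
  obtain ⟨K, t, ht, hK⟩ := hh.exists_lipschitzOnWith
  have hproj : Tendsto (fun q : X × Y => (q.1, (0 : Y))) (𝓝 (z, 0)) (𝓝 (z, 0)) :=
    Continuous.tendsto (by fun_prop) (z, 0)
  refine ⟨K, ?_⟩
  filter_upwards [ht, hproj.eventually ht] with q hq hq0
  have hdiff : q - (q.1, 0) = (0, q.2) := by ext <;> simp
  simpa [hdiff] using hK.norm_sub_le hq hq0

variable [IsManifold 𝓘(ℝ, E) ∞ M] (R : Retraction E M) {p : M} {z : E}

/-- The retraction `R` in the chart around `p`: the coordinates of `R_x η` as a function of the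
coordinates of `x` and `η`. -/
def chartRetraction (p : M) (q : E × E) : E :=
  φ p (R ((φ p).symm q.1) (vecAt p q.1 q.2))

/-- The derivative of `chartRetraction` in the second variable, along the tangent space. -/
def fiberDeriv (p : M) (q : E × E) : E →L[ℝ] E :=
  (fderiv ℝ (chartRetraction R p) q).comp (ContinuousLinearMap.inr ℝ E E)

lemma contMDiffAt_retraction_vecAt {q : E × E} (hq : q.1 ∈ (φ p).target) :
    ContMDiffAt 𝓘(ℝ, E × E) 𝓘(ℝ, E) ∞
      (fun q : E × E => R ((φ p).symm q.1) (vecAt p q.1 q.2)) q :=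
  R.smooth.contMDiffAt.comp q <| (contMDiffOn_vecAt p).contMDiffAt <|
    ((isOpen_extChartAt_target p).prod isOpen_univ).mem_nhds (show q ∈ _ ×ˢ univ from ⟨hq, trivial⟩)

lemma contDiffAt_chartRetraction {q : E × E} (hq : q.1 ∈ (φ p).target)
    (hR : R ((φ p).symm q.1) (vecAt p q.1 q.2) ∈ (chartAt E p).source) :
    ContDiffAt ℝ ∞ (chartRetraction R p) q :=
  contMDiffAt_iff_contDiffAt.1 <|
    (contMDiffAt_extChartAt' hR).comp q (contMDiffAt_retraction_vecAt R hq)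

lemma retraction_zero_mem_source (hz : z ∈ (φ p).target) :
    R ((φ p).symm z) (vecAt p z 0) ∈ (chartAt E p).source := by
  rw [map_zero, R.map_zero]
  exact chart_symm_mem_source hz

lemma chartRetraction_zero (hz : z ∈ (φ p).target) : chartRetraction R p (z, 0) = z := by
  simp only [chartRetraction, map_zero, R.map_zero]
  exact (φ p).right_inv hz

lemma chart_symm_chartRetraction {q : E × E}
    (hR : R ((φ p).symm q.1) (vecAt p q.1 q.2) ∈ (chartAt E p).source) :
    (φ p).symm (chartRetraction R p q) = R ((φ p).symm q.1) (vecAt p q.1 q.2) :=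
  (φ p).left_inv (by rwa [extChartAt_source])

lemma chartRetraction_chartVecL (hz : z ∈ (φ p).target)
    (η : TangentSpace 𝓘(ℝ, E) ((φ p).symm z)) :
    chartRetraction R p (z, chartVecL p _ η) = φ p (R ((φ p).symm z) η) := by
  simp only [chartRetraction, vecAt_chartVecL hz]

lemma continuous_retraction (x : M) : Continuous (R x) :=
  R.smooth.continuous.comp
    (FiberBundle.continuous_totalSpaceMk E (fun x : M => TangentSpace 𝓘(ℝ, E) x) x)

lemma hasDerivAt_chartRetraction_smul (hz : z ∈ (φ p).target) (u : E) :
    HasDerivAt (fun t : ℝ => chartRetraction R p (z, t • u)) u 0 := by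
  set x := (φ p).symm z
  set γ : ℝ → M := fun t => R x (t • vecAt p z u)
  have hγ : MDifferentiableAt 𝓘(ℝ, ℝ) 𝓘(ℝ, E) γ 0 := by
    have hline : ContMDiffAt 𝓘(ℝ, ℝ) 𝓘(ℝ, E × E) ∞ (fun t : ℝ => (z, t • u)) 0 :=
      ContDiffAt.contMDiffAt (by fun_prop)
    refine (((contMDiffAt_retraction_vecAt R (q := (z, (0 : ℝ) • u)) hz).comp (0 : ℝ)
      hline).mdifferentiableAt (by simp)).congr_of_eventuallyEq (.of_forall fun t => ?_)
    simp only [Function.comp_apply, map_smul]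
    rfl
  have hγ0 : γ 0 = x := (congrArg (R x) (zero_smul ℝ (vecAt p z u))).trans (R.map_zero x)
  have hcoord : HasFDerivAt (φ p ∘ γ)
      ((chartVecL p (γ 0)).comp (mfderiv 𝓘(ℝ, ℝ) 𝓘(ℝ, E) γ 0) : ℝ →L[ℝ] E) (0 : ℝ) :=
    ((mdifferentiableAt_extChartAt (by rw [hγ0]; exact chart_symm_mem_source hz)).hasMFDerivAt.comp
      (0 : ℝ) hγ.hasMFDerivAt).hasFDerivAt
  have hvel : ∀ (y : M) (w : TangentSpace 𝓘(ℝ, E) y), y = x → (w : E) = (vecAt p z u : E) →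
      chartVecL p y w = u := by
    rintro y w rfl hw
    rw [show w = vecAt p z u from hw, chartVecL_vecAt hz]
  refine (hcoord.hasDerivAt.congr_deriv (hvel _ _ hγ0 (R.deriv_zero x _))).congr_of_eventuallyEq
    (.of_forall fun t => ?_)
  simp only [chartRetraction, map_smul]
  rfl

lemma hasStrictFDerivAt_chartRetraction {v : E} (hz : z ∈ (φ p).target)
    (hR : R ((φ p).symm z) (vecAt p z v) ∈ (chartAt E p).source) :
    HasStrictFDerivAt (fun v => chartRetraction R p (z, v)) (fiberDeriv R p (z, v)) v :=
  ((contDiffAt_chartRetraction (q := (z, v)) R hz hR).hasStrictFDerivAt (by simp)).comp v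
    ((hasStrictFDerivAt_const z v).prodMk (hasStrictFDerivAt_id v))

lemma fiberDeriv_zero (hz : z ∈ (φ p).target) :
    fiberDeriv R p (z, 0) = ContinuousLinearMap.id ℝ E := by
  ext u
  have hline : HasDerivAt (fun t : ℝ => t • u) u 0 := by
    simpa using (hasDerivAt_id (0 : ℝ)).smul_const u
  have hfiber := (hasStrictFDerivAt_chartRetraction R hz
    (retraction_zero_mem_source R hz)).hasFDerivAt
  rw [← zero_smul ℝ u] at hfiber
  have hcomp := hfiber.comp_hasDerivAt (0 : ℝ) hline
  rw [zero_smul] at hcomp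
  exact hcomp.unique (hasDerivAt_chartRetraction_smul R hz u)

lemma exists_chartRetraction_estimates (p : M) :
    ∃ C : ℝ≥0, ∀ᶠ q : E × E in 𝓝 (φ p p, 0),
      ‖chartRetraction R p q - q.1‖ ≤ C * ‖q.2‖ ∧
      ‖fiberDeriv R p q - ContinuousLinearMap.id ℝ E‖ ≤ C * ‖q.2‖ := by
  have hz := mem_extChartAt_target (I := 𝓘(ℝ, E)) p
  have hsmooth : ContDiffAt ℝ ∞ (chartRetraction R p) (φ p p, 0) :=
    contDiffAt_chartRetraction R hz (retraction_zero_mem_source R hz)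
  have hfiber : ContDiffAt ℝ 1 (fiberDeriv R p) (φ p p, 0) :=
    (hsmooth.fderiv_right (m := 1) (WithTop.coe_le_coe.2 le_top)).clm_comp contDiffAt_const
  obtain ⟨C₁, h₁⟩ := exists_norm_sub_le_snd (hsmooth.of_le (m := 1) (by simp))
  obtain ⟨C₂, h₂⟩ := exists_norm_sub_le_snd hfiber
  refine ⟨max C₁ C₂, ?_⟩
  filter_upwards [h₁, h₂, continuousAt_fst.eventually
    (extChartAt_target_mem_nhds (I := 𝓘(ℝ, E)) p)] with q hq₁ hq₂ hq
  rw [chartRetraction_zero R hq] at hq₁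
  rw [fiberDeriv_zero R hq] at hq₂
  exact ⟨hq₁.trans (by gcongr; exact le_max_left _ _),
    hq₂.trans (by gcongr; exact le_max_right _ _)⟩

lemma tendsto_retraction_vecAt (p : M) :
    Tendsto (fun q : E × E => R ((φ p).symm q.1) (vecAt p q.1 q.2)) (𝓝 (φ p p, 0)) (𝓝 p) := by
  simpa only [ContinuousAt, map_zero, R.map_zero, extChartAt_to_inv] using
    (contMDiffAt_retraction_vecAt (q := (φ p p, 0)) R (mem_extChartAt_target p)).continuousAt

lemma tendsto_chartRetraction (p : M) :
    Tendsto (chartRetraction R p) (𝓝 (φ p p, 0)) (𝓝 (φ p p)) :=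
  (continuousAt_extChartAt (I := 𝓘(ℝ, E)) p).tendsto.comp (tendsto_retraction_vecAt R p)

end RetractionInChart

/-! ### Change of tangent space and local estimates of a step -/

section Transition

variable [IsManifold 𝓘(ℝ, E) ∞ M] (R : Retraction E M) {p : M} {z v : E}

lemma exists_rightInverse_chartRetraction [CompleteSpace E] (hz : z ∈ (φ p).target) :
    ∃ σ : E → E, σ z = 0 ∧ HasStrictFDerivAt σ (ContinuousLinearMap.id ℝ E) z ∧
      ∀ᶠ w in 𝓝 z, chartRetraction R p (z, σ w) = w := by
  have hfiber := hasStrictFDerivAt_chartRetraction R hz (retraction_zero_mem_source R hz)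
  rw [fiberDeriv_zero R hz] at hfiber
  have hequiv : HasStrictFDerivAt (fun v => chartRetraction R p (z, v))
    (ContinuousLinearEquiv.refl ℝ E : E →L[ℝ] E) 0 := hfiber
  have hz0 := chartRetraction_zero R hz
  refine ⟨hequiv.localInverse, ?_, ?_, ?_⟩
  · simpa only [hz0] using hequiv.localInverse_apply_image
  · have h := hequiv.to_localInverse
    rwa [hz0] at h
  · have h := hequiv.eventually_right_inverse
    rwa [hz0] at h

lemma eventually_retraction_mem_source {x : M} {η : TangentSpace 𝓘(ℝ, E) x}
    (hR : R x η ∈ (chartAt E p).source) : ∀ᶠ η' in 𝓝 η, R x η' ∈ (φ p).source := by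
  rw [extChartAt_source]
  exact (continuous_retraction R x).continuousAt.eventually ((chartAt E p).open_source.mem_nhds hR)

variable [RiemannianBundle (fun x : M => TangentSpace 𝓘(ℝ, E) x)]

lemma hasStrictFDerivAt_chart_retraction (hz : z ∈ (φ p).target)
    (hR : R ((φ p).symm z) (vecAt p z v) ∈ (chartAt E p).source) :
    HasStrictFDerivAt (fun η => φ p (R ((φ p).symm z) η))
      ((fiberDeriv R p (z, v)).comp (chartVecL p ((φ p).symm z))) (vecAt p z v) := by
  have hfiber := hasStrictFDerivAt_chartRetraction R hz hR
  rw [← chartVecL_vecAt hz v] at hfiber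
  simpa only [Function.comp_def, chartRetraction_chartVecL R hz, chartVecL_vecAt hz] using
    hfiber.comp (vecAt p z v) (chartVecL p ((φ p).symm z)).hasStrictFDerivAt

lemma hasStrictFDerivAt_comp_retraction {f : M → ℝ} {G : E →L[ℝ] ℝ} (hz : z ∈ (φ p).target)
    (hR : R ((φ p).symm z) (vecAt p z v) ∈ (chartAt E p).source)
    (hG : HasStrictFDerivAt (f ∘ (φ p).symm) G (chartRetraction R p (z, v))) :
    HasStrictFDerivAt (fun η => f (R ((φ p).symm z) η))
      (G.comp ((fiberDeriv R p (z, v)).comp (chartVecL p ((φ p).symm z)))) (vecAt p z v) := by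
  refine (hG.comp (vecAt p z v) (hasStrictFDerivAt_chart_retraction R hz hR)).congr_of_eventuallyEq
    ?_
  filter_upwards [eventually_retraction_mem_source R hR] with η hη
  simp only [Function.comp_apply, (φ p).left_inv hη]

/-- The change of tangent space `R_y⁻¹ ∘ R_x` near a vector `η` with `R_x η = y`. -/
lemma exists_transition [CompleteSpace E] {zy : E} (hz : z ∈ (φ p).target)
    (hR : R ((φ p).symm z) (vecAt p z v) ∈ (chartAt E p).source)
    (hzy : chartRetraction R p (z, v) = zy) :
    ∃ ψ : TangentSpace 𝓘(ℝ, E) ((φ p).symm z) → TangentSpace 𝓘(ℝ, E) ((φ p).symm zy),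
      ψ (vecAt p z v) = 0 ∧
      HasStrictFDerivAt ψ ((vecAt p zy).comp
        ((fiberDeriv R p (z, v)).comp (chartVecL p ((φ p).symm z)))) (vecAt p z v) ∧
      ∀ᶠ η in 𝓝 (vecAt p z v), R ((φ p).symm zy) (ψ η) = R ((φ p).symm z) η := by
  have hsource : (φ p).source = (chartAt E p).source := extChartAt_source 𝓘(ℝ, E) p
  have hzyT : zy ∈ (φ p).target := hzy ▸ (φ p).map_source (hsource ▸ hR)
  obtain ⟨σ, hσ0, hσ, hσr⟩ := exists_rightInverse_chartRetraction R hzyT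
  have hcoord := hasStrictFDerivAt_chart_retraction R hz hR
  change φ p (R ((φ p).symm z) (vecAt p z v)) = zy at hzy
  rw [← hzy] at hσ
  have hψ := (vecAt p zy).hasStrictFDerivAt.comp (vecAt p z v) (hσ.comp (vecAt p z v) hcoord)
  rw [ContinuousLinearMap.id_comp] at hψ
  have hψ0 : vecAt p zy (σ (φ p (R ((φ p).symm z) (vecAt p z v)))) = 0 := by
    rw [hzy, hσ0, map_zero]
  refine ⟨_, hψ0, hψ, ?_⟩
  have hlim := hcoord.continuousAt.tendsto
  have hψlim := hψ.continuousAt.eventually (p := fun η => R ((φ p).symm zy) η ∈ (φ p).source) <| by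
    simp only [hψ0]
    exact eventually_retraction_mem_source R
      ((R.map_zero _).symm ▸ chart_symm_mem_source hzyT)
  rw [hzy] at hlim
  filter_upwards [eventually_retraction_mem_source R hR, hlim.eventually hσr, hψlim]
    with η hη hinv hψη
  exact (φ p).injOn hψη hη hinv

variable [FiniteDimensional ℝ E] {f g : M → ℝ} {Lt : ℝ}

/-- In the chart around `p`, the differential at `η` of `f ∘ R_x - ⟨grad f x, ·⟩ - Lt / 2 ‖·‖ ^ 2`,
the function whose sum with the proximal objective at `x` is `(f + g) ∘ R_x`. -/
noncomputable def modelErrorDeriv (f : M → ℝ) (Lt : ℝ) (p : M) (q : E × E) : E →L[ℝ] ℝ :=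
  (fderiv ℝ (f ∘ (φ p).symm) (chartRetraction R p q)).comp (fiberDeriv R p q)
    - fderiv ℝ (f ∘ (φ p).symm) q.1 - Lt • metricForm p q.1 q.2

lemma hasStrictFDerivAt_modelError (hf : MDifferentiable 𝓘(ℝ, E) 𝓘(ℝ, ℝ) f)
    (hz : z ∈ (φ p).target) (hR : R ((φ p).symm z) (vecAt p z v) ∈ (chartAt E p).source)
    (hG : HasStrictFDerivAt (f ∘ (φ p).symm)
      (fderiv ℝ (f ∘ (φ p).symm) (chartRetraction R p (z, v))) (chartRetraction R p (z, v))) :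
    HasStrictFDerivAt
      (fun η => f (R ((φ p).symm z) η) - (inner ℝ (grad f ((φ p).symm z)) η + Lt / 2 * ‖η‖ ^ 2))
      ((modelErrorDeriv R f Lt p (z, v)).comp (chartVecL p ((φ p).symm z))) (vecAt p z v) := by
  have hmodel := ((innerSL ℝ (grad f ((φ p).symm z))).hasStrictFDerivAt (x := vecAt p z v)).fun_add
    ((hasStrictFDerivAt_norm_sq (vecAt p z v)).const_mul (Lt / 2))
  refine ((hasStrictFDerivAt_comp_retraction R hz hR hG).fun_sub hmodel).congr_fderiv ?_
  ext η
  have hgrad := fderiv_comp_chart_symm_apply hf hz (chartVecL p _ η)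
  have hmetric : metricForm p z v (chartVecL p _ η) = inner ℝ (vecAt p z v) η :=
    congrArg (inner ℝ (vecAt p z v)) (vecAt_chartVecL hz η)
  rw [vecAt_chartVecL hz] at hgrad
  simp only [modelErrorDeriv, ContinuousLinearMap.comp_apply, sub_apply,
    add_apply, smul_apply, innerSL_apply_apply, hgrad, hmetric,
    smul_eq_mul, nsmul_eq_mul]
  ring

lemma modelErrorDeriv_le_clarkeDirDeriv {zy : E} (hf : MDifferentiable 𝓘(ℝ, E) 𝓘(ℝ, ℝ) f)
    (hz : z ∈ (φ p).target) (hR : R ((φ p).symm z) (vecAt p z v) ∈ (chartAt E p).source)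
    (hzy : chartRetraction R p (z, v) = zy)
    (hG : HasStrictFDerivAt (f ∘ (φ p).symm) (fderiv ℝ (f ∘ (φ p).symm) zy) zy)
    {K : ℝ≥0} {U : Set (TangentSpace 𝓘(ℝ, E) ((φ p).symm zy))} (hU : U ∈ 𝓝 0)
    (hK : LipschitzOnWith K (fun η => f (R _ η) + g (R _ η)) U)
    (h0 : 0 ∈ clarkeSubdiff (proxObj R f g Lt ((φ p).symm z)) (vecAt p z v)) (u : E) :
    ((modelErrorDeriv R f Lt p (z, v) u : ℝ) : EReal) ≤
      clarkeDirDeriv (fun η => f (R ((φ p).symm zy) η) + g (R ((φ p).symm zy) η)) 0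
        (vecAt p zy (fiberDeriv R p (z, v) u)) := by
  have : CompleteSpace E := FiniteDimensional.complete ℝ E
  obtain ⟨ψ, hψ0, hψ, hψR⟩ := exists_transition R hz hR hzy
  have herror := (hasStrictFDerivAt_modelError R (Lt := Lt) hf hz hR (hzy.symm ▸ hG)).fun_neg
  have hprox : proxObj R f g Lt ((φ p).symm z) =ᶠ[𝓝 (vecAt p z v)] fun η =>
      (f (R _ (ψ η)) + g (R _ (ψ η)))
        + -(f (R _ η) - (inner ℝ (grad f ((φ p).symm z)) η + Lt / 2 * ‖η‖ ^ 2)) := by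
    filter_upwards [hψR] with η hη
    rw [hη, proxObj]
    ring
  have hle := h0 (vecAt p z u)
  rw [inner_zero_left, clarkeDirDeriv_congr hprox] at hle
  have hchain := hle.trans (clarkeDirDeriv_comp_add_le hψ herror (hψ0.symm ▸ hU) hK _)
  simp only [hψ0, ContinuousLinearMap.comp_apply, neg_apply,
    chartVecL_vecAt hz] at hchain
  rwa [EReal.coe_neg, ← sub_eq_add_neg, EReal.coe_zero,
    EReal.sub_nonneg (by simp) (by simp)] at hchain

end Transition

section ChartEstimates

variable [IsManifold 𝓘(ℝ, E) ∞ M] [RiemannianBundle (fun x : M => TangentSpace 𝓘(ℝ, E) x)]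
  [IsContMDiffRiemannianBundle 𝓘(ℝ, E) ∞ E (fun x : M => TangentSpace 𝓘(ℝ, E) x)] {p : M}

lemma exists_norm_le_norm_vecAt (p : M) :
    ∃ C : ℝ≥0, ∀ᶠ z in 𝓝 (φ p p), ∀ v, ‖v‖ ≤ C * ‖vecAt p z v‖ := by
  obtain ⟨C, hC⟩ := exists_norm_chartVecL_le (E := E) p
  refine ⟨C, ?_⟩
  filter_upwards [extChartAt_target_mem_nhds (I := 𝓘(ℝ, E)) p, (tendsto_chart_symm p).eventually hC]
    with z hz hCz v
  simpa only [chartVecL_vecAt hz] using hCz (vecAt p z v)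

lemma exists_forall_of_eventually_vecAt {P : ∀ x : M, TangentSpace 𝓘(ℝ, E) x → Prop}
    (h : ∀ᶠ q : E × E in 𝓝 (φ p p, 0), P ((φ p).symm q.1) (vecAt p q.1 q.2)) :
    ∃ V ∈ 𝓝 p, ∃ δ > 0, ∀ x ∈ V, ∀ η, ‖η‖ < δ → P x η := by
  obtain ⟨C, hC⟩ := exists_norm_chartVecL_le (E := E) p
  rw [nhds_prod_eq] at h
  obtain ⟨Q, hQ, Q', hQ', hQQ'⟩ := eventually_prod_iff.1 h
  obtain ⟨r, hr, hball⟩ := Metric.eventually_nhds_iff_ball.1 hQ'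
  refine ⟨_, inter_mem (inter_mem (extChartAt_source_mem_nhds (I := 𝓘(ℝ, E)) p)
    ((continuousAt_extChartAt (I := 𝓘(ℝ, E)) p).eventually hQ)) hC, r / (C + 1), by positivity, ?_⟩
  rintro x ⟨⟨hx, hxQ⟩, hxC⟩
  obtain ⟨z, hz, rfl⟩ : ∃ z ∈ (φ p).target, (φ p).symm z = x :=
    ⟨_, (φ p).map_source hx, (φ p).left_inv hx⟩
  intro η hη
  have hzQ : Q z := (φ p).right_inv hz ▸ hxQ
  rw [← vecAt_chartVecL hz η]
  refine hQQ' hzQ (hball (chartVecL p _ η) (mem_ball_zero_iff.2 ?_))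
  calc ‖chartVecL p ((φ p).symm z) η‖ ≤ (C + 1) * ‖η‖ :=
        (hxC η).trans (by gcongr; exact le_add_of_nonneg_right zero_le_one)
    _ < r := by rwa [lt_div_iff₀' (by positivity)] at hη

variable [IsRiemannianManifold 𝓘(ℝ, E) M]

lemma exists_edist_retraction_le (R : Retraction E M) (p : M) :
    ∃ C : ℝ≥0, ∀ᶠ q : E × E in 𝓝 (φ p p, 0),
      edist ((φ p).symm q.1) (R ((φ p).symm q.1) (vecAt p q.1 q.2)) ≤ C * ‖q.2‖ₑ := by
  obtain ⟨Ce, U, hU, he⟩ := exists_lipschitzOnWith_chart_symm (E := E) p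
  obtain ⟨Cr, hr⟩ := exists_chartRetraction_estimates R p
  refine ⟨Ce * Cr, ?_⟩
  filter_upwards [continuousAt_fst.eventually_mem hU,
    (tendsto_chartRetraction R p).eventually_mem hU,
    (tendsto_retraction_vecAt R p).eventually (chart_source_mem_nhds E p), hr]
    with q hqU hzyU hR hrq
  have hstep : edist q.1 (chartRetraction R p q) ≤ Cr * ‖q.2‖ₑ := by
    rw [edist_comm, edist_eq_enorm_sub]
    exact ENNReal.coe_le_coe.2 hrq.1
  calc edist ((φ p).symm q.1) (R ((φ p).symm q.1) (vecAt p q.1 q.2))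
      ≤ Ce * edist q.1 (chartRetraction R p q) :=
        chart_symm_chartRetraction R hR ▸ he hqU hzyU
    _ ≤ (Ce * Cr : ℝ≥0) * ‖q.2‖ₑ := by
        rw [ENNReal.coe_mul, mul_assoc]
        gcongr

end ChartEstimates

section StepEstimates

lemma exists_rightInverse_of_norm_sub_id_le [CompleteSpace E] {T : E →L[ℝ] E}
    (hT : ‖T - ContinuousLinearMap.id ℝ E‖ ≤ 1 / 2) :
    ∃ S : E →L[ℝ] E, T.comp S = ContinuousLinearMap.id ℝ E ∧ ‖S‖ ≤ 2 := by
  set u : (E →L[ℝ] E)ˣ := Units.oneSub (ContinuousLinearMap.id ℝ E - T)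
    (by rw [norm_sub_rev]; linarith)
  have hu : (u : E →L[ℝ] E) = T := sub_sub_cancel _ _
  have hinv : T.comp (↑u⁻¹ : E →L[ℝ] E) = ContinuousLinearMap.id ℝ E := hu ▸ u.mul_inv
  refine ⟨_, hinv, ContinuousLinearMap.opNorm_le_bound _ zero_le_two fun w => ?_⟩
  set v := (↑u⁻¹ : E →L[ℝ] E) w
  have hv : (T - ContinuousLinearMap.id ℝ E) v = w - v :=
    congrArg (· - v) (DFunLike.congr_fun hinv w)
  have hle := (T - ContinuousLinearMap.id ℝ E).le_of_opNorm_le hT v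
  rw [hv, norm_sub_rev] at hle
  linarith [norm_sub_norm_le v w]

variable [FiniteDimensional ℝ E] [IsManifold 𝓘(ℝ, E) ∞ M]
  [RiemannianBundle (fun x : M => TangentSpace 𝓘(ℝ, E) x)] {R : Retraction E M} {f g F : M → ℝ}
  {Lt : ℝ} {p : M} {z v : E}

lemma exists_lipschitzOnWith_comp_retraction (hF : IsLocallyLipschitzWrt R F) (x : M) :
    ∃ K, ∃ U ∈ 𝓝 (0 : TangentSpace 𝓘(ℝ, E) x), LipschitzOnWith K (fun η => F (R x η)) U := by
  have : LocallyCompactSpace M := Manifold.locallyCompact_of_finiteDimensional 𝓘(ℝ, E)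
  obtain ⟨K, hK, hKx⟩ := exists_compact_mem_nhds x
  obtain ⟨L, hL⟩ := hF K hK
  refine ⟨L.toNNReal, R x ⁻¹' K, ((continuous_retraction R x).tendsto' 0 x (R.map_zero x)) hKx,
    .of_dist_le_mul fun ξ hξ η hη => ?_⟩
  refine (hL x (mem_of_mem_nhds hKx) ξ η hξ hη).trans ?_
  rw [dist_eq_norm ξ]
  gcongr
  exact L.le_coe_toNNReal

lemma exists_mem_subdiff_of_stationary (hf : MDifferentiable 𝓘(ℝ, E) 𝓘(ℝ, ℝ) f)
    (hF : IsLocallyLipschitzWrt R (fun y => f y + g y)) (hz : z ∈ (φ p).target)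
    (hR : R ((φ p).symm z) (vecAt p z v) ∈ (chartAt E p).source)
    (hG : HasStrictFDerivAt (f ∘ (φ p).symm)
      (fderiv ℝ (f ∘ (φ p).symm) (chartRetraction R p (z, v))) (chartRetraction R p (z, v)))
    {S : E →L[ℝ] E} (hS : (fiberDeriv R p (z, v)).comp S = ContinuousLinearMap.id ℝ E)
    (h0 : 0 ∈ clarkeSubdiff (proxObj R f g Lt ((φ p).symm z)) (vecAt p z v)) :
    ∃ ζ ∈ subdiff R (fun y => f y + g y) (R ((φ p).symm z) (vecAt p z v)),
      ‖ζ‖ ≤ ‖(modelErrorDeriv R f Lt p (z, v)).comp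
        (S.comp (chartVecL p (R ((φ p).symm z) (vecAt p z v))))‖ := by
  obtain ⟨zy, hzy⟩ : ∃ zy, chartRetraction R p (z, v) = zy := ⟨_, rfl⟩
  have hy : R ((φ p).symm z) (vecAt p z v) = (φ p).symm zy :=
    hzy ▸ (chart_symm_chartRetraction R (q := (z, v)) hR).symm
  have hzyT : zy ∈ (φ p).target := hzy ▸ (φ p).map_source ((extChartAt_source 𝓘(ℝ, E) p).symm ▸ hR)
  obtain ⟨K, U, hU, hK⟩ := exists_lipschitzOnWith_comp_retraction hF ((φ p).symm zy)
  have hle := modelErrorDeriv_le_clarkeDirDeriv R hf hz hR hzy (hzy ▸ hG) hU hK h0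
  have : FiniteDimensional ℝ (TangentSpace 𝓘(ℝ, E) ((φ p).symm zy)) :=
    inferInstanceAs (FiniteDimensional ℝ E)
  have : CompleteSpace (TangentSpace 𝓘(ℝ, E) ((φ p).symm zy)) := FiniteDimensional.complete ℝ _
  rw [hy]
  refine ⟨(InnerProductSpace.toDual ℝ _).symm ((modelErrorDeriv R f Lt p (z, v)).comp
    (S.comp (chartVecL p _))), fun w => ?_, (LinearIsometryEquiv.norm_map _ _).le⟩
  rw [InnerProductSpace.toDual_symm_apply]
  have hw := hle (S (chartVecL p _ w))
  rwa [← ContinuousLinearMap.comp_apply (fiberDeriv R p (z, v)), hS,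
    ContinuousLinearMap.id_apply, vecAt_chartVecL hzyT] at hw

variable [IsContMDiffRiemannianBundle 𝓘(ℝ, E) ∞ E (fun x : M => TangentSpace 𝓘(ℝ, E) x)]
  [IsRiemannianManifold 𝓘(ℝ, E) M]

lemma exists_norm_modelErrorDeriv_le (R : Retraction E M) (Lt : ℝ)
    (hf : IsLocallyLipschitzDifferentiable E f) (p : M) :
    ∃ C : ℝ≥0, ∀ᶠ q : E × E in 𝓝 (φ p p, 0), ‖modelErrorDeriv R f Lt p q‖ ≤ C * ‖q.2‖ := by
  set G := fderiv ℝ (f ∘ (φ p).symm)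
  obtain ⟨K, U, hU, hK⟩ := exists_lipschitzOnWith_fderiv_comp_chart_symm hf p
  obtain ⟨Cr, hr⟩ := exists_chartRetraction_estimates R p
  obtain ⟨Cm, hm⟩ := exists_norm_metricForm_le (E := E) p
  have hG : ∀ᶠ z in 𝓝 (φ p p), ‖G z‖ ≤ ‖G (φ p p)‖₊ + 1 :=
    (((hK.continuousOn.continuousAt hU).norm).eventually_lt_const (lt_add_one _)).mono
      fun z hz => hz.le
  have hsmall : ∀ᶠ q : E × E in 𝓝 (φ p p, 0), Cr * ‖q.2‖ < 1 :=
    (Continuous.tendsto' (by fun_prop) _ 0 (by simp)).eventually_lt_const one_pos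
  refine ⟨K * Cr * 2 + (‖G (φ p p)‖₊ + 1) * Cr + ‖Lt‖₊ * Cm, ?_⟩
  filter_upwards [continuousAt_fst.eventually (hm.and (hG.and (eventually_mem_set.2 hU))),
    (tendsto_chartRetraction R p).eventually_mem hU, hr, hsmall]
    with q ⟨hmq, hGq, hqU⟩ hzyU ⟨hrq, hTq⟩ hsq
  set T := fiberDeriv R p q
  have hTnorm : ‖T‖ ≤ 2 := by
    have := norm_le_norm_add_norm_sub' T (ContinuousLinearMap.id ℝ E)
    linarith [ContinuousLinearMap.norm_id_le (𝕜 := ℝ) (E := E)]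
  have hGsub : ‖G (chartRetraction R p q) - G q.1‖ ≤ K * (Cr * ‖q.2‖) :=
    (hK.norm_sub_le hzyU hqU).trans (by gcongr)
  calc ‖modelErrorDeriv R f Lt p q‖
      = ‖(G (chartRetraction R p q) - G q.1).comp T
          + (G q.1).comp (T - ContinuousLinearMap.id ℝ E) - Lt • metricForm p q.1 q.2‖ := by
        rw [modelErrorDeriv, ContinuousLinearMap.sub_comp, ContinuousLinearMap.comp_sub,
          ContinuousLinearMap.comp_id, sub_add_sub_cancel]
    _ ≤ ‖G (chartRetraction R p q) - G q.1‖ * ‖T‖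
          + ‖G q.1‖ * ‖T - ContinuousLinearMap.id ℝ E‖ + ‖Lt‖ * ‖metricForm p q.1 q.2‖ :=
        (norm_sub_le _ _).trans <| add_le_add ((norm_add_le _ _).trans <| add_le_add
          (ContinuousLinearMap.opNorm_comp_le _ _) (ContinuousLinearMap.opNorm_comp_le _ _))
          (norm_smul _ _).le
    _ ≤ K * (Cr * ‖q.2‖) * 2 + (‖G (φ p p)‖₊ + 1) * (Cr * ‖q.2‖) + ‖Lt‖ * (Cm * ‖q.2‖) := by
        gcongr
        exact hmq q.2
    _ = _ := by push_cast; ring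

lemma exists_mem_subdiff_norm_le (Lt : ℝ) (hf : IsLocallyLipschitzDifferentiable E f)
    (hF : IsLocallyLipschitzWrt R (fun y => f y + g y)) (p : M) :
    ∃ C : ℝ≥0, ∀ᶠ q : E × E in 𝓝 (φ p p, 0),
      0 ∈ clarkeSubdiff (proxObj R f g Lt ((φ p).symm q.1)) (vecAt p q.1 q.2) →
      ∃ ζ ∈ subdiff R (fun y => f y + g y) (R ((φ p).symm q.1) (vecAt p q.1 q.2)),
        ‖ζ‖ ≤ C * ‖q.2‖ := by
  have : CompleteSpace E := FiniteDimensional.complete ℝ E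
  obtain ⟨Cm, hm⟩ := exists_norm_modelErrorDeriv_le R Lt hf p
  obtain ⟨Cr, hr⟩ := exists_chartRetraction_estimates R p
  obtain ⟨Cv, hv⟩ := exists_norm_chartVecL_le (E := E) p
  have hsmall : ∀ᶠ q : E × E in 𝓝 (φ p p, 0), Cr * ‖q.2‖ < 1 / 2 :=
    (Continuous.tendsto' (by fun_prop) _ 0 (by simp)).eventually_lt_const one_half_pos
  refine ⟨Cm * (2 * Cv), ?_⟩
  filter_upwards [continuousAt_fst.eventually (extChartAt_target_mem_nhds (I := 𝓘(ℝ, E)) p),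
    (tendsto_retraction_vecAt R p).eventually
      ((eventually_mem_set.2 (chart_source_mem_nhds E p)).and hv),
    (tendsto_chartRetraction R p).eventually (eventually_hasStrictFDerivAt_comp_chart_symm hf p),
    hr, hm, hsmall] with q hz ⟨hR, hvq⟩ hG hrq hmq hsq h0
  obtain ⟨S, hS, hS2⟩ := exists_rightInverse_of_norm_sub_id_le (hrq.2.trans hsq.le)
  obtain ⟨ζ, hζ, hζn⟩ := exists_mem_subdiff_of_stationary hf.1 hF hz hR hG hS h0
  refine ⟨ζ, hζ, hζn.trans ?_⟩
  calc _ ≤ (Cm * ‖q.2‖) * (2 * Cv) := by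
        refine (ContinuousLinearMap.opNorm_comp_le _ _).trans (mul_le_mul hmq
          ((ContinuousLinearMap.opNorm_comp_le _ _).trans ?_) (by positivity) (by positivity))
        exact mul_le_mul hS2 (ContinuousLinearMap.opNorm_le_bound _ Cv.2 hvq) (by positivity)
          zero_le_two
    _ = _ := by push_cast; ring

lemma exists_step_estimates (Lt : ℝ) (hf : IsLocallyLipschitzDifferentiable E f)
    (hF : IsLocallyLipschitzWrt R (fun y => f y + g y)) {U : Set M} (hU : U ∈ 𝓝 p) :
    ∃ V ∈ 𝓝 p, ∃ δ > 0, ∃ C : ℝ≥0, ∀ x ∈ V, ∀ η : TangentSpace 𝓘(ℝ, E) x, ‖η‖ < δ →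
      R x η ∈ U ∧ edist x (R x η) ≤ C * ‖η‖ₑ ∧
      (0 ∈ clarkeSubdiff (proxObj R f g Lt x) η →
        ∃ ζ ∈ subdiff R (fun y => f y + g y) (R x η), ‖ζ‖ ≤ C * ‖η‖) ∧
      ∀ η' : TangentSpace 𝓘(ℝ, E) x, ‖η'‖ < δ →
        |(f (R x η) + g (R x η)) - (f (R x η') + g (R x η'))| ≤ C * ‖η - η'‖ := by
  have : LocallyCompactSpace M := Manifold.locallyCompact_of_finiteDimensional 𝓘(ℝ, E)
  obtain ⟨K, hK, hKp⟩ := exists_compact_mem_nhds p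
  obtain ⟨LF, hLF⟩ := hF K hK
  obtain ⟨Cs, hs⟩ := exists_mem_subdiff_norm_le Lt hf hF p
  obtain ⟨Ce, he⟩ := exists_edist_retraction_le R p
  obtain ⟨Cv, hv⟩ := exists_norm_le_norm_vecAt (E := E) p
  obtain ⟨V, hV, δ, hδ, hVδ⟩ := exists_forall_of_eventually_vecAt (p := p)
    (P := fun x η => (R x η ∈ U ∧ R x η ∈ K) ∧ edist x (R x η) ≤ (Ce * Cv : ℝ≥0) * ‖η‖ₑ ∧
      (0 ∈ clarkeSubdiff (proxObj R f g Lt x) η →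
        ∃ ζ ∈ subdiff R (fun y => f y + g y) (R x η), ‖ζ‖ ≤ (Cs * Cv : ℝ≥0) * ‖η‖)) <| by
    filter_upwards [continuousAt_fst.eventually hv, hs, he,
      (tendsto_retraction_vecAt R p).eventually_mem (inter_mem hU hKp)] with q hvq hsq heq hRU
    have hq : ‖q.2‖ ≤ Cv * ‖vecAt p q.1 q.2‖ := hvq q.2
    have hq' : ‖q.2‖ₑ ≤ Cv * ‖vecAt p q.1 q.2‖ₑ := ENNReal.coe_le_coe.2 hq
    refine ⟨hRU, heq.trans ?_, fun h0 => ?_⟩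
    · rw [ENNReal.coe_mul, mul_assoc]
      gcongr
    · obtain ⟨ζ, hζ, hζn⟩ := hsq h0
      refine ⟨ζ, hζ, hζn.trans ?_⟩
      rw [NNReal.coe_mul, mul_assoc]
      gcongr
  refine ⟨V ∩ K, inter_mem hV hKp, δ, hδ, Ce * Cv + Cs * Cv + LF.toNNReal, fun x hx η hη => ?_⟩
  obtain ⟨⟨hU', hK'⟩, hedist, hsub⟩ := hVδ x hx.1 η hη
  refine ⟨hU', hedist.trans ?_, fun h0 => ?_, fun η' hη' => ?_⟩
  · gcongr
    exact le_add_right le_self_add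
  · obtain ⟨ζ, hζ, hζn⟩ := hsub h0
    refine ⟨ζ, hζ, hζn.trans ?_⟩
    gcongr
    exact le_add_right le_add_self
  · refine (hLF x hx.2 η η' hK' (hVδ x hx.1 η' hη').1.2).trans ?_
    gcongr
    exact LF.le_coe_toNNReal.trans (NNReal.coe_le_coe.2 le_add_self)

end StepEstimates

/-! ### Convergence -/

section Convergence

lemma antitone_of_mul_sq_le_sub {n s : ℕ → ℝ} {β : ℝ} (hβ : 0 ≤ β)
    (h : ∀ k, β * n k ^ 2 ≤ s k - s (k + 1)) : Antitone s :=
  antitone_nat_of_succ_le fun k => sub_nonneg.1 ((by positivity : 0 ≤ β * n k ^ 2).trans (h k))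

lemma tendsto_zero_of_mul_sq_le_sub {n s : ℕ → ℝ} {β l : ℝ} (hβ : 0 < β)
    (h : ∀ k, β * n k ^ 2 ≤ s k - s (k + 1)) (hs : Tendsto s atTop (𝓝 l)) :
    Tendsto n atTop (𝓝 0) := by
  have hsub : Tendsto (fun k => (s k - s (k + 1)) / β) atTop (𝓝 0) := by
    simpa only [sub_self, zero_div] using
      (hs.sub ((tendsto_add_atTop_iff_nat 1).2 hs)).div_const β
  have hsq : Tendsto (fun k => n k ^ 2) atTop (𝓝 0) :=
    squeeze_zero (fun k => sq_nonneg _) (fun k => (le_div_iff₀' hβ).2 (h k)) hsub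
  exact squeeze_zero_norm (fun k => (Real.sqrt_sq_eq_abs (n k)).ge)
    (by simpa only [Real.sqrt_zero] using hsq.sqrt)

lemma tendsto_comp_of_mapClusterPt_of_antitone {X : Type*} [TopologicalSpace X] {x : ℕ → X}
    {F : X → ℝ} {p : X} (hF : ContinuousAt F p) (hx : Antitone fun k => F (x k))
    (hp : MapClusterPt p atTop x) : Tendsto (fun k => F (x k)) atTop (𝓝 (F p)) := by
  obtain ⟨u, hu, hlim⟩ := (hp.continuousAt_comp hF).tendsto_subseq
  exact (tendsto_iff_tendsto_subseq_of_antitone hx hu.tendsto_atTop).2 hlim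

lemma tsum_lt_top_of_eventually_le {u v : ℕ → ℝ≥0∞} (hu : ∀ k, u k < ⊤) (hv : ∑' k, v k < ⊤)
    (h : ∀ᶠ k in atTop, u k ≤ v k) : ∑' k, u k < ⊤ := by
  obtain ⟨n, hn⟩ := eventually_atTop.1 h
  rw [← (ENNReal.summable (f := fun k => u (k + n))).sum_add_tsum_nat_add']
  refine ENNReal.add_lt_top.2 ⟨ENNReal.sum_lt_top.2 fun k _ => hu k, lt_of_le_of_lt ?_ hv⟩
  exact (ENNReal.tsum_le_tsum fun k => hn _ (Nat.le_add_left n k)).trans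
    (ENNReal.tsum_comp_le_tsum_of_injective (add_left_injective n) v)

lemma exists_setOf_mapClusterPt_eq_singleton {X : Type*} [EMetricSpace X] {x : ℕ → X} {K : Set X}
    (h : ∑' k, edist (x k) (x (k + 1)) < ⊤) (hK : IsCompact K) (hx : ∀ k, x k ∈ K) :
    ∃ y, {z : X | MapClusterPt z atTop x} = {y} := by
  have hcauchy : CauchySeq x := cauchySeq_of_edist_le_of_tsum_ne_top _ (fun k => le_rfl) h.ne
  obtain ⟨y, -, hy⟩ := hK.exists_mapClusterPt_of_frequently (Frequently.of_forall (f := atTop) hx)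
  have hxy : Tendsto x atTop (𝓝 y) := le_nhds_of_cauchy_adhp hcauchy hy
  exact ⟨y, Subset.antisymm (fun z hz => eq_of_nhds_neBot (hz.neBot.mono (inf_le_inf_left _ hxy)))
    (singleton_subset_iff.2 hy)⟩

/-- `ς` is a desingularizing function on `[0, t)`. The interval is half-open and bounded, so that
`deriv ς` is meaningful at each of its points but `0`. -/
structure IsDesingularizing (ς : ℝ → ℝ) (t : ℝ) : Prop where
  pos : 0 < t
  concaveOn : ConcaveOn ℝ (Ico 0 t) ς
  nonneg : ∀ b ∈ Ico 0 t, 0 ≤ ς b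
  deriv_pos : ∀ b ∈ Ioo 0 t, 0 < deriv ς b

lemma IsDesingularizing.summable_sub_succ {ς : ℝ → ℝ} {a : ℕ → ℝ} {t : ℝ}
    (hς : IsDesingularizing ς t) (ha : Antitone a) (ha0 : Tendsto a atTop (𝓝 0)) :
    Summable fun k => ς (a k) - ς (a (k + 1)) := by
  obtain ⟨n, hn⟩ := eventually_atTop.1 (ha0.eventually_lt_const hς.pos)
  have hmem : ∀ k, a (k + n) ∈ Ico 0 t := fun k =>
    ⟨ha.le_of_tendsto ha0 _, hn _ (Nat.le_add_left n k)⟩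
  have hanti : Antitone fun k => ς (a (k + n)) := antitone_nat_of_succ_le fun k =>
    le_of_concaveOn_of_deriv_pos hς.concaveOn (hmem (k + 1)) (hmem k) le_rfl (ha (by omega))
      fun hlt => hς.deriv_pos _ ⟨(hmem (k + 1)).1.trans_lt hlt, (hmem k).2⟩
  have hsum := summable_sub_succ_of_antitone hanti fun k => hς.nonneg _ (hmem k)
  rw [← summable_nat_add_iff n]
  simpa only [Nat.add_right_comm] using hsum

lemma IsDesingularizing.sub_le_add_mul_sub {ς : ℝ → ℝ} {t a a' b X m : ℝ}
    (hς : IsDesingularizing ς t) (ha' : 0 ≤ a') (haa : a' ≤ a) (hat : a + X < t)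
    (hX : |b - a| ≤ X) (hm : 0 ≤ m) (hKL : b ∈ Ioo 0 t → 1 ≤ deriv ς b * m) :
    a - a' ≤ X + m * (ς a - ς a') := by
  have hat' : a < t := by linarith [(abs_nonneg _).trans hX]
  have hb : a' < b → b ∈ Ioo 0 t := fun h => ⟨ha'.trans_lt h, by linarith [(abs_le.1 hX).2]⟩
  exact sub_le_add_mul_sub_of_concaveOn hς.concaveOn ⟨ha', haa.trans_lt hat'⟩
    ⟨ha'.trans haa, hat'⟩ (fun h => Ioo_subset_Ico_self (hb h)) haa hX hm
    (fun h => hς.deriv_pos _ ⟨ha'.trans_lt h, hat'⟩) (fun h => hKL (hb h))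

section StepBound

variable [RiemannianBundle (fun x : M => TangentSpace 𝓘(ℝ, E) x)]

/-- The bounds on the steps `ηh k` starting in `s`, all but finitely many, from which the
summability of the whole sequence of steps follows once `s` contains all iterates. The constant and
the summable sequence may depend on `s`, so that the bounds can be established locally. -/
def HasStepBound (ε : ℕ → ℝ) (x : ℕ → M) (ηh ηs : ∀ k, TangentSpace 𝓘(ℝ, E) (x k)) (s : Set M) :
    Prop :=
  ∃ C : ℝ≥0, ∃ D : ℕ → ℝ, (∀ k, 0 ≤ D k) ∧ Summable D ∧ ∀ᶠ k in atTop, x k ∈ s →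
    edist (x k) (x (k + 1)) ≤ C * ‖ηh k‖ₑ ∧
    ‖ηh (k + 1)‖ ^ 2 ≤ C * ε k ^ 2 + ‖ηs k‖ * D k

variable {ε : ℕ → ℝ} {x : ℕ → M} {ηh ηs : ∀ k, TangentSpace 𝓘(ℝ, E) (x k)} {s t K : Set M}

lemma HasStepBound.of_eventually_notMem (h : ∀ᶠ k in atTop, x k ∉ s) :
    HasStepBound ε x ηh ηs s :=
  ⟨0, 0, fun _ => le_rfl, summable_zero, h.mono fun _ hk hs => absurd hs hk⟩

lemma HasStepBound.mono (hst : s ⊆ t) (h : HasStepBound ε x ηh ηs t) :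
    HasStepBound ε x ηh ηs s := by
  obtain ⟨C, D, hD0, hD, hk⟩ := h
  exact ⟨C, D, hD0, hD, hk.mono fun k h hs => h (hst hs)⟩

lemma HasStepBound.union (hs : HasStepBound ε x ηh ηs s) (ht : HasStepBound ε x ηh ηs t) :
    HasStepBound ε x ηh ηs (s ∪ t) := by
  obtain ⟨C, D, hD0, hD, hk⟩ := hs
  obtain ⟨C', D', hD0', hD', hk'⟩ := ht
  refine ⟨C + C', D + D', fun k => add_nonneg (hD0 k) (hD0' k), hD.add hD', ?_⟩
  filter_upwards [hk, hk'] with k h h' hu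
  rcases hu with hu | hu
  · refine ⟨(h hu).1.trans ?_, (h hu).2.trans ?_⟩ <;> gcongr
    exacts [le_self_add, le_self_add, le_add_of_nonneg_right (hD0' k)]
  · refine ⟨(h' hu).1.trans ?_, (h' hu).2.trans ?_⟩ <;> gcongr
    exacts [le_add_self, le_add_self, le_add_of_nonneg_left (hD0 k)]

lemma HasStepBound.of_isCompact (hK : IsCompact K)
    (h : ∀ p, MapClusterPt p atTop x → ∃ V ∈ 𝓝 p, HasStepBound ε x ηh ηs V) :
    HasStepBound ε x ηh ηs K := by
  refine hK.induction_on (p := HasStepBound ε x ηh ηs)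
    (.of_eventually_notMem (.of_forall fun _ => notMem_empty _)) (fun s t => .mono)
    (fun s t => .union) fun p _ => ?_
  obtain ⟨V, hV, hVb⟩ : ∃ V ∈ 𝓝 p, HasStepBound ε x ηh ηs V := by
    by_cases hp : MapClusterPt p atTop x
    · exact h p hp
    · rw [mapClusterPt_iff_frequently] at hp
      push Not at hp
      exact hp.imp fun V hV => hV.imp_right .of_eventually_notMem
  exact ⟨V, mem_nhdsWithin_of_mem_nhds hV, hVb⟩

lemma HasStepBound.summable_norm (h : HasStepBound ε x ηh ηs K) (hxK : ∀ k, x k ∈ K)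
    (hε0 : ∀ k, 0 ≤ ε k) (hε : Summable ε) (hηs : ∀ k, ‖ηs k‖ ≤ ‖ηh k‖ + ε k ^ 2) :
    Summable fun k => ‖ηh k‖ := by
  obtain ⟨C, D, hD0, hD, hC⟩ := h
  obtain ⟨n, hn⟩ := eventually_atTop.1 hC
  rw [← summable_nat_add_iff n]
  refine summable_of_sq_succ_le (m := fun k => ‖ηs (k + n)‖) C.2 (fun k => norm_nonneg _)
    (fun k => norm_nonneg _) (fun k => hε0 (k + n)) (fun k => hD0 (k + n))
    ((summable_nat_add_iff n).2 hε) ((summable_nat_add_iff n).2 hD) (fun k => hηs _) fun k => ?_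
  rw [Nat.add_right_comm]
  exact (hn (k + n) (Nat.le_add_left n k) (hxK _)).2

lemma HasStepBound.tsum_edist_lt_top (h : HasStepBound ε x ηh ηs K) (hxK : ∀ k, x k ∈ K)
    (hfin : ∀ k, edist (x k) (x (k + 1)) < ⊤) (hsum : Summable fun k => ‖ηh k‖) :
    ∑' k, edist (x k) (x (k + 1)) < ⊤ := by
  obtain ⟨C, D, -, -, hC⟩ := h
  refine tsum_lt_top_of_eventually_le hfin ?_ (hC.mono fun k hk => (hk (hxK k)).1)
  rw [ENNReal.tsum_mul_left]
  refine ENNReal.mul_lt_top ENNReal.coe_lt_top ?_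
  simp only [← ofReal_norm]
  exact hsum.tsum_ofReal_lt_top

end StepBound

variable [IsManifold 𝓘(ℝ, E) ∞ M]

lemma edist_retraction_lt_top (R : Retraction E M) (x : M) (η : TangentSpace 𝓘(ℝ, E) x) :
    edist (R x η) x < ⊤ := by
  have hcont : Continuous fun t : ℝ => R x (t • η) :=
    (continuous_retraction R x).comp (continuous_id.smul continuous_const)
  have hclopen : IsClopen (Metric.eball x ⊤) := ⟨Metric.isClosed_eball_top, Metric.isOpen_eball⟩
  have huniv := (hclopen.preimage hcont).eq_univ ⟨0, by simp [R.map_zero]⟩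
  have hone : (1 : ℝ) ∈ (fun t : ℝ => R x (t • η)) ⁻¹' Metric.eball x ⊤ := huniv ▸ mem_univ _
  simpa only [mem_preimage, one_smul, Metric.mem_eball] using hone

variable [RiemannianBundle (fun x : M => TangentSpace 𝓘(ℝ, E) x)] {R : Retraction E M}

lemma HasKLAt.exists_one_le_deriv_mul_norm {h : M → ℝ} {p : M} (hKL : HasKLAt R h p) :
    ∃ U ∈ 𝓝 p, ∃ ς t, IsDesingularizing ς t ∧
      ∀ y ∈ U, ∀ ζ ∈ subdiff R h y, h y - h p ∈ Ioo 0 t → 1 ≤ deriv ς (h y - h p) * ‖ζ‖ := by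
  obtain ⟨ε, hε, U, hU, ς, -, hconc, hnn, -, -, hd, hineq⟩ := hKL
  obtain ⟨t, ht0, htε⟩ := EReal.lt_iff_exists_real_btwn.1 hε
  have hlt : ∀ b < t, (b : EReal) < ε := fun b hb => (EReal.coe_lt_coe_iff.2 hb).trans htε
  refine ⟨U, hU, ς, t, ⟨EReal.coe_pos.1 ht0,
    hconc.subset (fun b hb => ⟨hb.1, (hlt b hb.2).le⟩) (convex_Ico 0 t),
    fun b hb => hnn b hb.1 (hlt b hb.2).le, fun b hb => hd b hb.1 (hlt b hb.2)⟩,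
    fun y hy ζ hζ hyp => ?_⟩
  rw [← ENNReal.one_le_ofReal, ENNReal.ofReal_mul (hd _ hyp.1 (hlt _ hyp.2)).le, ofReal_norm]
  exact (hineq y hy (sub_pos.1 hyp.1) (hlt _ hyp.2)).trans
    (mul_le_mul_right (iInf₂_le ζ hζ) _)

variable [FiniteDimensional ℝ E] {f g : M → ℝ} {Lt β : ℝ} {ε : ℕ → ℝ} {x : ℕ → M}
  {ηh ηs : ∀ k, TangentSpace 𝓘(ℝ, E) (x k)}

lemma IsIRPG.mul_sq_norm_le_sub {q : ℝ → ℝ → ℝ} (hx : IsIRPG R f g Lt q ε x ηh ηs) {L : ℝ}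
    {N : Set M} (hxN : ∀ k, x k ∈ N) (hfL : IsRetractionSmooth R f L N) (k : ℕ) :
    (Lt - L) / 2 * ‖ηh k‖ ^ 2 ≤ f (x k) + g (x k) - (f (x (k + 1)) + g (x (k + 1))) := by
  have hsmooth := hfL (x k) (hxN k) {ηh k}
    (by simpa only [image_singleton, singleton_subset_iff, ← hx.step k] using hxN (k + 1)) _ rfl
  have hdecrease := hx.decrease k
  simp only [proxObj, inner_zero_right, norm_zero, R.map_zero] at hdecrease
  rw [← hx.step k] at hsmooth hdecrease
  linarith

lemma IsIRPG.antitone {q : ℝ → ℝ → ℝ} (hx : IsIRPG R f g Lt q ε x ηh ηs) {L : ℝ} (hL : L ≤ Lt)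
    {N : Set M} (hxN : ∀ k, x k ∈ N) (hfL : IsRetractionSmooth R f L N) :
    Antitone fun k => f (x k) + g (x k) :=
  antitone_of_mul_sq_le_sub (div_nonneg (sub_nonneg.2 hL) zero_le_two)
    (hx.mul_sq_norm_le_sub hxN hfL)

lemma IsIRPG.edist_succ_lt_top {q : ℝ → ℝ → ℝ} (hx : IsIRPG R f g Lt q ε x ηh ηs) (k : ℕ) :
    edist (x k) (x (k + 1)) < ⊤ := by
  rw [hx.step k, edist_comm]
  exact edist_retraction_lt_top R (x k) (ηh k)

lemma IsIRPG.norm_le_norm_add_sq (hx : IsIRPG R f g Lt (fun e _ => e ^ 2) ε x ηh ηs) (k : ℕ) :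
    ‖ηs k‖ ≤ ‖ηh k‖ + ε k ^ 2 :=
  (norm_le_norm_add_norm_sub (ηh k) (ηs k)).trans (by gcongr; exact hx.accuracy k)

variable [IsContMDiffRiemannianBundle 𝓘(ℝ, E) ∞ E (fun x : M => TangentSpace 𝓘(ℝ, E) x)]
  [IsRiemannianManifold 𝓘(ℝ, E) M]

lemma HasKLAt.exists_sub_le_add_mul_sub {p : M} (hKL : HasKLAt R (fun y => f y + g y) p)
    (Lt : ℝ) (hf : IsLocallyLipschitzDifferentiable E f)
    (hF : IsLocallyLipschitzWrt R (fun y => f y + g y)) :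
    ∃ V ∈ 𝓝 p, ∃ δ > 0, ∃ ς t, IsDesingularizing ς t ∧ ∃ C : ℝ≥0, ∀ x ∈ V,
      ∀ η : TangentSpace 𝓘(ℝ, E) x, ‖η‖ < δ → edist x (R x η) ≤ C * ‖η‖ₑ ∧
        ∀ η' : TangentSpace 𝓘(ℝ, E) x, ‖η'‖ < δ → 0 ∈ clarkeSubdiff (proxObj R f g Lt x) η' →
          ∀ a a' e, f (R x η) + g (R x η) - (f p + g p) = a → 0 ≤ a' → a' ≤ a →
            ‖η - η'‖ ≤ e → a + C * e < t → a - a' ≤ C * e + C * ‖η'‖ * (ς a - ς a') := by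
  obtain ⟨U, hU, ς, t, hς, hineq⟩ := hKL.exists_one_le_deriv_mul_norm
  obtain ⟨V, hV, δ, hδ, C, hest⟩ := exists_step_estimates Lt hf hF hU
  refine ⟨V, hV, δ, hδ, ς, t, hς, C, fun x hx η hη => ?_⟩
  obtain ⟨-, hedist, -, hlip⟩ := hest x hx η hη
  refine ⟨hedist, fun η' hη' h0 a a' e ha ha' haa he hat => ?_⟩
  obtain ⟨hU', -, hsub, -⟩ := hest x hx η' hη'
  obtain ⟨ζ, hζ, hζn⟩ := hsub h0
  refine hς.sub_le_add_mul_sub (b := f (R x η') + g (R x η') - (f p + g p)) ha' haa hat ?_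
    (by positivity) fun hb => (hineq _ hU' ζ hζ hb).trans (by
      gcongr
      exact (hς.deriv_pos _ hb).le)
  rw [← ha, sub_sub_sub_cancel_right, abs_sub_comm]
  exact (hlip η' hη').trans (by gcongr)

lemma IsIRPG.exists_hasStepBound (hx : IsIRPG R f g Lt (fun e _ => e ^ 2) ε x ηh ηs)
    (hf : IsLocallyLipschitzDifferentiable E f)
    (hF : IsLocallyLipschitzWrt R (fun y => f y + g y)) {p : M}
    (hKL : HasKLAt R (fun y => f y + g y) p) (hβ : 0 < β)
    (hdesc : ∀ k, β * ‖ηh k‖ ^ 2 ≤ f (x k) + g (x k) - (f (x (k + 1)) + g (x (k + 1))))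
    (hlim : Tendsto (fun k => f (x k) + g (x k)) atTop (𝓝 (f p + g p)))
    (hε : Tendsto ε atTop (𝓝 0)) :
    ∃ V ∈ 𝓝 p, HasStepBound ε x ηh ηs V := by
  obtain ⟨V, hV, δ, hδ, ς, t, hς, C, hest⟩ := hKL.exists_sub_le_add_mul_sub Lt hf hF
  obtain ⟨a, ha⟩ : ∃ a : ℕ → ℝ, ∀ k, f (x k) + g (x k) - (f p + g p) = a k := ⟨_, fun _ => rfl⟩
  have hanti : Antitone a :=
    funext ha ▸ (antitone_of_mul_sq_le_sub hβ.le hdesc).add_const (-(f p + g p))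
  have ha0 : Tendsto a atTop (𝓝 0) := by
    simpa only [ha, sub_self] using hlim.sub_const (f p + g p)
  have hηh : Tendsto (fun k => ‖ηh k‖) atTop (𝓝 0) := tendsto_zero_of_mul_sq_le_sub hβ hdesc hlim
  have hηs : Tendsto (fun k => ‖ηs k‖) atTop (𝓝 0) :=
    squeeze_zero (fun k => norm_nonneg _) hx.norm_le_norm_add_sq (by simpa using hηh.add (hε.pow 2))
  have hsmall : Tendsto (fun k => a (k + 1) + C * ε k ^ 2) atTop (𝓝 0) := by
    simpa using ((tendsto_add_atTop_iff_nat 1).2 ha0).add ((hε.pow 2).const_mul (C : ℝ))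
  lift β to ℝ≥0 using hβ.le
  refine ⟨V, hV, C + C / β, fun k => C / β * |ς (a (k + 1)) - ς (a (k + 2))|,
    fun k => by positivity, ((summable_nat_add_iff 1).2
      (hς.summable_sub_succ hanti ha0).abs).mul_left _, ?_⟩
  filter_upwards [hsmall.eventually_lt_const hς.pos, hηh.eventually_lt_const hδ,
    hηs.eventually_lt_const hδ] with k hkt hηhk hηsk hkV
  obtain ⟨hedist, hdecrease⟩ := hest (x k) hkV (ηh k) hηhk
  rw [← hx.step k] at hedist hdecrease
  refine ⟨hedist.trans (by gcongr; exact le_self_add), ?_⟩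
  calc ‖ηh (k + 1)‖ ^ 2 ≤ (a (k + 1) - a (k + 2)) / β := by
        rw [le_div_iff₀' hβ, ← ha, ← ha, sub_sub_sub_cancel_right]
        exact hdesc (k + 1)
    _ ≤ (C * ε k ^ 2 + C * ‖ηs k‖ * |ς (a (k + 1)) - ς (a (k + 2))|) / β := by
        gcongr
        refine (hdecrease (ηs k) hηsk (hx.stationary k) _ _ _ (ha _)
          (hanti.le_of_tendsto ha0 (k + 2)) (hanti (Nat.le_succ _)) (hx.accuracy k) hkt).trans ?_
        gcongr
        exact le_abs_self _
    _ = C / β * ε k ^ 2 + ‖ηs k‖ * (C / β * |ς (a (k + 1)) - ς (a (k + 2))|) := by ring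
    _ ≤ (C + C / β : ℝ≥0) * ε k ^ 2 + ‖ηs k‖ * (C / β * |ς (a (k + 1)) - ς (a (k + 2))|) := by
        gcongr
        exact_mod_cast le_add_self

end Convergence

end IRPG

theorem theorem3p2_general
    {E : Type*} [NormedAddCommGroup E] [NormedSpace ℝ E] [FiniteDimensional ℝ E]
    {M : Type*} [EMetricSpace M] [ChartedSpace E M] [IsManifold 𝓘(ℝ, E) ∞ M]
    [RiemannianBundle (fun x : M => TangentSpace 𝓘(ℝ, E) x)]
    [IsContMDiffRiemannianBundle 𝓘(ℝ, E) ∞ E (fun x : M => TangentSpace 𝓘(ℝ, E) x)]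
    [IsRiemannianManifold 𝓘(ℝ, E) M]
    (R : IRPG.Retraction E M) (f g : M → ℝ) (hg : Continuous g) (L Lt : ℝ) (hL : L < Lt)
    (ε : ℕ → ℝ) (hε : Summable ε)
    (x : ℕ → M) (ηh ηs : ∀ k, TangentSpace 𝓘(ℝ, E) (x k))
    (hx : IRPG.IsIRPG R f g Lt (fun e _ => e ^ 2) ε x ηh ηs)
    (K : Set M) (hK : IsCompact K) (hxK : ∀ k, x k ∈ K) (N : Set M) (hxN : ∀ k, x k ∈ N)
    (hfL : IRPG.IsRetractionSmooth R f L N)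
    (hf : IRPG.IsLocallyLipschitzDifferentiable E f)
    (hF : IRPG.IsLocallyLipschitzWrt R (fun y => f y + g y))
    (hKL : ∀ y, MapClusterPt y atTop x → IRPG.HasKLAt R (fun y => f y + g y) y) :
    ∑' k, edist (x k) (x (k + 1)) < ⊤ ∧ ∃ y, {z : M | MapClusterPt z atTop x} = {y} := by
  have hβ : 0 < (Lt - L) / 2 := half_pos (sub_pos.2 hL)
  have hdesc := hx.mul_sq_norm_le_sub hxN hfL
  have hlim : ∀ p, MapClusterPt p atTop x →
      Tendsto (fun k => f (x k) + g (x k)) atTop (𝓝 (f p + g p)) := fun p hp =>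
    IRPG.tendsto_comp_of_mapClusterPt_of_antitone (F := fun y => f y + g y)
      (hf.1.continuous.add hg).continuousAt (hx.antitone hL.le hxN hfL) hp
  have hbound : IRPG.HasStepBound ε x ηh ηs K := .of_isCompact hK fun p hp =>
    hx.exists_hasStepBound hf hF (hKL p hp) hβ hdesc (hlim p hp) hε.tendsto_atTop_zero
  have hsum : Summable fun k => ‖ηh k‖ :=
    hbound.summable_norm hxK (fun k => (hx.eps_pos k).le) hε hx.norm_le_norm_add_sq
  have hedist := hbound.tsum_edist_lt_top hxK hx.edist_succ_lt_top hsum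
  exact ⟨hedist, IRPG.exists_setOf_mapClusterPt_eq_singleton hedist hK hxK⟩

theorem theorem3p2
    {E : Type*} [NormedAddCommGroup E] [NormedSpace ℝ E] [FiniteDimensional ℝ E]
    {M : Type*} [EMetricSpace M] [ChartedSpace E M] [IsManifold 𝓘(ℝ, E) ∞ M]
    [RiemannianBundle (fun x : M => TangentSpace 𝓘(ℝ, E) x)]
    [IsContMDiffRiemannianBundle 𝓘(ℝ, E) ∞ E (fun x : M => TangentSpace 𝓘(ℝ, E) x)]
    [IsRiemannianManifold 𝓘(ℝ, E) M]
    (R : IRPG.Retraction E M) (f g : M → ℝ) (hg : Continuous g)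
    (L Lt : ℝ) (hLt : 0 < Lt) (hL : L < Lt)
    (ε : ℕ → ℝ) (hε : Summable ε)
    (x : ℕ → M) (ηh ηs : ∀ k, TangentSpace 𝓘(ℝ, E) (x k))
    (hx : IRPG.IsIRPG R f g Lt (fun e _ => e ^ 2) ε x ηh ηs)
    (hbdd : BddBelow (range (fun y => f y + g y)))
    (hcomp : IsCompact {y : M | f y + g y ≤ f (x 0) + g (x 0)})
    (N : Set M) (hN : {y : M | f y + g y ≤ f (x 0) + g (x 0)} ⊆ N) (hxN : ∀ k, x k ∈ N)
    (hfL : IRPG.IsRetractionSmooth R f L N)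
    (hf : IRPG.IsLocallyLipschitzDifferentiable E f)
    (hF : IRPG.IsLocallyLipschitzWrt R (fun y => f y + g y))
    (hKL : ∀ y, MapClusterPt y atTop x → IRPG.HasKLAt R (fun y => f y + g y) y) :
    ∑' k, edist (x k) (x (k + 1)) < ⊤ ∧ ∃ y, {z : M | MapClusterPt z atTop x} = {y} :=
  theorem3p2_general R f g hg L Lt hL ε hε x ηh ηs hx _ hcomp
    (fun k => hx.antitone hL.le hxN hfL (Nat.zero_le k)) N hxN hfL hf hF hKL
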